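/- Let $\mathbb K$ be a field and let $\mathcal A$ be a central hyperplane arrangement in a finite-dimensional $\mathbb K$-vector space $V$, i.e. a finite set of linear hyperplanes of $V$. The Orlik–Solomon algebra $A(\mathcal A)$ is the quotient of the exterior algebra $E(\mathcal A)$ on the vector space with basis $\{e_H\mid H\in\mathcal A\}$ by the two-sided ideal generated by all $\partial(e_{H_1}\cdots e_{H_p})=\sum_{k=1}^p(-1)^{k-1}e_{H_1}\cdots\widehat{e_{H_k}}\cdots e_{H_p}$ with $H_1,\dots,H_p\in\mathcal A$ dependent, i.e. $\operatorname{codim}_V(H_1\cap\cdots\cap H_p)<p$. It is graded by the images $A(\mathcal A)_n$ of the components $\bigwedge^n$ of $E(\mathcal A)$; let $a_H$ be the image of $e_H$. For $B\subseteq\mathcal A$ let $[B]=\mathbb K+\sum_{H\in B}\mathbb K a_H\subseteq A(\mathcal A)$, with $1$ in degree $0$ and the $a_H$ in degree $1$; so $[\varnothing]=\mathbb K$. An empty tensor product is $\mathbb K$, and the empty product is $1$. Suppose that $\mathcal A\neq\varnothing$, and let $\pi=(\pi_1,\dots,\pi_s)$ be a partition of $\mathcal A$ into non-empty blocks. Let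 $H_0\in\pi_1$, let $\mathcal A'=\mathcal A\setminus\{H_0\}$, and let $\mathcal A''=\{H_0\cap H\mid H\in\mathcal A'\}$, a central arrangement in $H_0$. Put $\pi_i'=\pi_i\cap\mathcal A'$ for $1\le i\le s$. Suppose that the restriction map $R:\mathcal A\setminus\pi_1\to\mathcal A''$, $H\mapsto H\cap H_0$, is bijective, and put $\pi_i''=R(\pi_i)$ for $2\le i\le s$. Then any two of the following statements imply the third: (i) the multiplication map $\kappa:[\pi_1]\otimes\cdots\otimes[\pi_s]\to A(\mathcal A)$, $x_1\otimes\cdots\otimes x_s\mapsto x_1\cdots x_s$, is an isomorphism of graded $\mathbb K$-vector spaces; (ii) the multiplication map $\kappa':[\pi_1']\otimes\cdots\otimes[\pi_s']\to A(\mathcal A')$ is an isomorphism of graded $\mathbb K$-vector spaces; (iii) the multiplication map $\kappa'':[\pi_2'']\otimes\cdots\otimes[\pi_s'']\to A(\mathcal A'')$ is an isomorphism of graded $\mathbb K$-vector spaces. -/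

import Mathlib

open scoped TensorProduct

universe u v

/-- A (finite, central) hyperplane arrangement in a `K`-vector space `V`: a finite set of linear
hyperplanes of `V`, a linear hyperplane being a maximal proper subspace (equivalently, a subspace of
codimension one). -/
structure CentralArrangement (K : Type u) (V : Type v) [Field K] [AddCommGroup V] [Module K V] where
  /-- the set of hyperplanes -/
  carrier : Set (Submodule K V)
  finite_carrier : carrier.Finite
  isCoatom_of_mem : ∀ H ∈ carrier, IsCoatom H

namespace CentralArrangement

variable {K : Type u} {V : Type v} [Field K] [AddCommGroup V] [Module K V]

/-- The trace `H ∩ X` of a subspace `H` of `V` on a subspace `X`, as a subspace of `X`.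
For `X = H₀` this is the underlying rule of the restriction map `R : H ↦ H ∩ H₀`. -/
def trace (X H : Submodule K V) : Submodule K X := H.comap X.subtype

theorem isCoatom_trace {X H : Submodule K V} (hH : IsCoatom H) (hX : ¬ X ≤ H) :
    IsCoatom (trace X H) := by
  refine ⟨fun h => hX fun x hx => ?_, fun N hN => ?_⟩
  · have : (⟨x, hx⟩ : X) ∈ trace X H := h ▸ Submodule.mem_top
    exact this
  · obtain ⟨n, hnN, hnH⟩ := SetLike.exists_of_lt hN
    have hn : (n : V) ∉ H := hnH
    have htop : H ⊔ Submodule.span K {(n : V)} = ⊤ := by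
      refine hH.2 _ (lt_of_le_of_ne le_sup_left fun h => hn ?_)
      rw [h]
      exact Submodule.mem_sup_right (Submodule.mem_span_singleton_self _)
    refine eq_top_iff.2 fun x _ => ?_
    have hx : (x : V) ∈ H ⊔ Submodule.span K {(n : V)} := htop ▸ Submodule.mem_top
    obtain ⟨h, hh, y, hy, hxy⟩ := Submodule.mem_sup.1 hx
    obtain ⟨c, rfl⟩ := Submodule.mem_span_singleton.1 hy
    have h1 : x - c • n ∈ trace X H := by
      change (x : V) - c • (n : V) ∈ H
      rw [← hxy, add_sub_cancel_right]
      exact hh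
    have h2 : x = (x - c • n) + c • n := by abel
    rw [h2]
    exact N.add_mem (hN.le h1) (N.smul_mem c hnN)

/-- The deletion `A' = A ∖ {H₀}`. -/
def deletion (A : CentralArrangement K V) (H₀ : Submodule K V) : CentralArrangement K V where
  carrier := A.carrier \ {H₀}
  finite_carrier := A.finite_carrier.subset Set.sdiff_subset
  isCoatom_of_mem := fun H hH => A.isCoatom_of_mem H hH.1

/-- The restriction `A^X = {X ∩ H | H ∈ A, X ⊄ H}`, an arrangement in `X`. For `X = H₀ ∈ A` this is
`A'' = {H₀ ∩ H | H ∈ A ∖ {H₀}}`. -/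
def restriction (A : CentralArrangement K V) (X : Submodule K V) : CentralArrangement K X where
  carrier := trace X '' {H | H ∈ A.carrier ∧ ¬ X ≤ H}
  finite_carrier := (A.finite_carrier.subset fun _ hH => hH.1).image _
  isCoatom_of_mem := by
    rintro _ ⟨H, ⟨hA, hX⟩, rfl⟩
    exact isCoatom_trace (A.isCoatom_of_mem H hA) hX

/-- `(P₁, …, Pₛ)` is a partition of `A`: the blocks are non-empty, pairwise disjoint, and their
union is `A`. -/
structure IsPartition (A : CentralArrangement K V) {s : ℕ} (P : Fin s → Set (Submodule K V)) :
    Prop where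
  nonempty : ∀ i, (P i).Nonempty
  disjoint : Pairwise fun i j => Disjoint (P i) (P j)
  iUnion_eq : ⋃ i, P i = A.carrier

/-! ### The Orlik–Solomon algebra -/

/-- The exterior algebra `E(A)` on the vector space with basis `{e_H | H ∈ A}`. -/
abbrev Ext (A : CentralArrangement K V) : Type (max u v) :=
  ExteriorAlgebra K (A.carrier →₀ K)

/-- The monomial `e_S = e_{H₁} ⋯ e_{Hₚ}` of a tuple `S = (H₁, …, Hₚ)` of hyperplanes. -/
noncomputable def monomial (A : CentralArrangement K V) {p : ℕ} (S : Fin p → A.carrier) : A.Ext :=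
  ExteriorAlgebra.ιMulti K p fun i => Finsupp.single (S i) (1 : K)

/-- The antiderivation `∂` of `E(A)` with `∂ e_H = 1`, so that
`∂ (e_{H₁} ⋯ e_{Hₚ}) = ∑ₖ (-1)^(k-1) e_{H₁} ⋯ ê_{Hₖ} ⋯ e_{Hₚ}`: contraction with the linear form
that takes the value `1` on each basis vector. -/
noncomputable def boundary (A : CentralArrangement K V) : A.Ext →ₗ[K] A.Ext :=
  CliffordAlgebra.contractLeft (Q := (0 : QuadraticForm K (A.carrier →₀ K)))
    (Finsupp.linearCombination K fun _ => (1 : K))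

theorem boundary_one (A : CentralArrangement K V) : A.boundary 1 = 0 :=
  CliffordAlgebra.contractLeft_one (Q := (0 : QuadraticForm K (A.carrier →₀ K))) _

theorem boundary_e_mul (A : CentralArrangement K V) (H : A.carrier) (x : A.Ext) :
    A.boundary (ExteriorAlgebra.ι K (Finsupp.single H 1) * x) =
      x - ExteriorAlgebra.ι K (Finsupp.single H 1) * A.boundary x := by
  have h := CliffordAlgebra.contractLeft_ι_mul
    (Q := (0 : QuadraticForm K (A.carrier →₀ K)))
    (d := Finsupp.linearCombination K fun _ => (1 : K)) (Finsupp.single H 1) x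
  simpa [boundary] using h

/-- A tuple `S = (H₁, …, Hₚ)` is dependent if `codim (H₁ ∩ ⋯ ∩ Hₚ) < p`. -/
def IsDependent (A : CentralArrangement K V) {p : ℕ} (S : Fin p → A.carrier) : Prop :=
  Module.finrank K (V ⧸ ⨅ i, (S i : Submodule K V)) < p

/-- The relations `∂ e_S = 0`, for `S` dependent. -/
def OSRel (A : CentralArrangement K V) (x y : A.Ext) : Prop :=
  ∃ (p : ℕ) (S : Fin p → A.carrier), A.IsDependent S ∧ x = A.boundary (A.monomial S) ∧ y = 0

/-- The Orlik–Solomon algebra `A(A)`: the quotient of `E(A)` by the two-sided ideal generated by the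
elements `∂ e_S`, for `S` dependent. -/
abbrev OSAlgebra (A : CentralArrangement K V) : Type (max u v) := RingQuot A.OSRel

/-- The generator `a_H`, the image of `e_H`. -/
noncomputable def gen (A : CentralArrangement K V) (H : A.carrier) : A.OSAlgebra :=
  RingQuot.mkAlgHom K A.OSRel (ExteriorAlgebra.ι K (Finsupp.single H 1))

/-- The homogeneous component of degree `n` of the Orlik–Solomon algebra: the image of `⋀ⁿ`. -/
noncomputable def component (A : CentralArrangement K V) (n : ℕ) : Submodule K A.OSAlgebra :=
  (⋀[K]^n (A.carrier →₀ K)).map (RingQuot.mkAlgHom K A.OSRel).toLinearMap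

/-! ### Tensor factorizations -/

/-- The subspace `[B] = K + ∑_{H ∈ B} K a_H` of the Orlik–Solomon algebra, for a set `B` of
hyperplanes of `A`. In particular `[∅] = K`. -/
noncomputable def blockSpace (A : CentralArrangement K V) (B : Set (Submodule K V)) : Submodule K A.OSAlgebra :=
  Submodule.span K {1} ⊔ Submodule.span K (A.gen '' {H | (H : Submodule K V) ∈ B})

/-- The multiplication map `κ : [P₁] ⊗ ⋯ ⊗ [Pₛ] → A(A)`, `x₁ ⊗ ⋯ ⊗ xₛ ↦ x₁ ⋯ xₛ`. -/
noncomputable def kappa (A : CentralArrangement K V) {s : ℕ} (P : Fin s → Set (Submodule K V)) :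
    (⨂[K] i, A.blockSpace (P i)) →ₗ[K] A.OSAlgebra :=
  PiTensorProduct.lift
    ((MultilinearMap.mkPiAlgebraFin K s A.OSAlgebra).compLinearMap
      fun i => (A.blockSpace (P i)).subtype)

/-- The homogeneous component of degree `n` of `[P₁] ⊗ ⋯ ⊗ [Pₛ]`, spanned by the tensors
`x₁ ⊗ ⋯ ⊗ xₛ` of homogeneous elements `xᵢ ∈ [Pᵢ]` whose degrees add up to `n`. -/
noncomputable def tensorComponent (A : CentralArrangement K V) {s : ℕ} (P : Fin s → Set (Submodule K V))
    (n : ℕ) : Submodule K (⨂[K] i, A.blockSpace (P i)) :=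
  Submodule.span K
    {t | ∃ (d : Fin s → ℕ) (x : ∀ i, A.blockSpace (P i)),
      ∑ i, d i = n ∧ (∀ i, (x i : A.OSAlgebra) ∈ A.component (d i)) ∧
        t = PiTensorProduct.tprod K x}

/-- `κ` is an isomorphism of graded `K`-vector spaces: it is bijective and carries the component of
degree `n` of the tensor product onto that of the Orlik–Solomon algebra, for each `n`. -/
def IsTensorFactorization (A : CentralArrangement K V) {s : ℕ}
    (P : Fin s → Set (Submodule K V)) : Prop :=
  Function.Bijective (A.kappa P) ∧
    ∀ n : ℕ, (A.tensorComponent P n).map (A.kappa P) = A.component n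

/-- The blocks `Pᵢ' = Pᵢ ∩ A'`. -/
def deletionBlocks (A : CentralArrangement K V) (H₀ : Submodule K V) {s : ℕ}
    (P : Fin s → Set (Submodule K V)) (i : Fin s) : Set (Submodule K V) :=
  P i ∩ (A.deletion H₀).carrier

/-- The blocks `Pᵢ'' = R(Pᵢ) = {H ∩ H₀ | H ∈ Pᵢ}`, for every index `i` but the first. -/
def restrictionBlocks (H₀ : Submodule K V) {s : ℕ}
    (P : Fin (s + 1) → Set (Submodule K V)) (i : Fin s) : Set (Submodule K H₀) :=
  trace H₀ '' P i.succ

end CentralArrangement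

/-! The engine is the deletion–restriction sequence 0 → A(𝒜') → A(𝒜) → A(𝒜'') → 0 (`incl_injective`,
`exact_incl_residue`, `residue_surjective`), whose second map strips off a leading a_{H₀} and
restricts the remaining hyperplanes to H₀. By `isTensorFactorization_iff`, a factorization means
that the products obtained by choosing 1 or some a_H in each block form a basis; the gradings then
match automatically. A choice for 𝒜 either avoids H₀, and is then a choice for 𝒜', or selects H₀ in
the first block, and is then a choice in the other blocks. In the second case the residue sends the
product to the one for 𝒜'', since R identifies the blocks. So a split exact sequence of free spaces
maps to the sequence above, and the short five lemma `bijective_two_of_three` gives all three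
implications.

Injectivity of A(𝒜') → A(𝒜), for any subarrangement, goes by induction on the degree. Modulo
relations an element of degree n is the sum of its localizations at subspaces X of codimension at
most n (`exists_sub_sum_localization_mem_relIdeal`). In such a localization all monomials of degree
n + 1 are relations, so y = ∂(e_H y) + e_H ∂y reduces y to ∂y, of lower degree.

Exactness in the middle uses an arbitrary choice of hyperplanes over 𝒜''. Relations of 𝒜'' lift to
relations involving H₀, and two hyperplanes with the same trace can be exchanged after
multiplication by a_{H₀}, up to elements of A(𝒜'). -/

namespace CentralArrangement

variable {K : Type u} {V : Type v} [Field K] [AddCommGroup V] [Module K V]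

/-! ### The exterior algebra of an arrangement -/

/-- The generator `e_H` of the exterior algebra. -/
noncomputable def e (A : CentralArrangement K V) (H : A.carrier) : A.Ext :=
  ExteriorAlgebra.ι K (Finsupp.single H (1 : K))

variable (A : CentralArrangement K V)

theorem e_mul_self (H : A.carrier) : A.e H * A.e H = 0 := ExteriorAlgebra.ι_sq_zero _

theorem e_mul_e_mul_self (H : A.carrier) (x : A.Ext) : A.e H * (A.e H * x) = 0 := by
  rw [← mul_assoc, e_mul_self, zero_mul]

theorem e_mul_e_comm (H L : A.carrier) : A.e H * A.e L = -(A.e L * A.e H) :=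
  eq_neg_of_add_eq_zero_left (ExteriorAlgebra.ι_add_mul_swap _ _)

theorem e_mul_e_mul_comm (H L : A.carrier) (x : A.Ext) :
    A.e H * (A.e L * x) = -(A.e L * (A.e H * x)) := by
  rw [← mul_assoc, e_mul_e_comm, neg_mul, mul_assoc]

variable {A}

theorem ι_mem_span_e (v : A.carrier →₀ K) :
    ExteriorAlgebra.ι K v ∈ Submodule.span K (Set.range A.e) := by
  induction v using Finsupp.induction_linear with
  | zero => simp
  | add f g hf hg => rw [map_add]; exact add_mem hf hg
  | single H c =>
    have : Finsupp.single H c = c • Finsupp.single H (1 : K) := by simp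
    rw [this, map_smul]
    exact Submodule.smul_mem _ _ (Submodule.subset_span ⟨H, rfl⟩)

theorem range_ι_eq_span_e :
    LinearMap.range (ExteriorAlgebra.ι K : (A.carrier →₀ K) →ₗ[K] A.Ext) =
      Submodule.span K (Set.range A.e) := by
  refine le_antisymm ?_ (Submodule.span_le.2 ?_)
  · rintro _ ⟨v, rfl⟩
    exact ι_mem_span_e v
  · rintro _ ⟨H, rfl⟩
    exact ⟨_, rfl⟩

/-- A subspace of the exterior algebra that contains `1` and is stable under left multiplication by
the generators is everything. -/
theorem mem_of_e_mul_mem (N : Submodule K A.Ext) (one : 1 ∈ N)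
    (e_mul : ∀ H, ∀ x ∈ N, A.e H * x ∈ N) (x : A.Ext) : x ∈ N := by
  induction x using CliffordAlgebra.left_induction with
  | algebraMap r =>
    rw [Algebra.algebraMap_eq_smul_one]
    exact N.smul_mem _ one
  | add x y hx hy => exact N.add_mem hx hy
  | ι_mul x v hx =>
    have : Submodule.span K (Set.range A.e) ≤ N.comap (LinearMap.mulRight K x) := by
      rw [Submodule.span_le]
      rintro _ ⟨H, rfl⟩
      exact e_mul H x hx
    exact this (ι_mem_span_e v)

theorem mul_mem_of_e_mul_mem (N : Submodule K A.Ext) (e_mul : ∀ H, ∀ x ∈ N, A.e H * x ∈ N)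
    (a : A.Ext) {x : A.Ext} (hx : x ∈ N) : a * x ∈ N := by
  have : a ∈ N.comap (LinearMap.mulRight K x) := by
    refine mem_of_e_mul_mem _ ?_ ?_ a
    · simpa using hx
    · intro H y hy
      have := e_mul H _ hy
      simpa [mul_assoc] using this
  exact this

theorem monomial_zero (S : Fin 0 → A.carrier) : A.monomial S = 1 :=
  ExteriorAlgebra.ιMulti_zero_apply _

theorem monomial_succ {p : ℕ} (S : Fin (p + 1) → A.carrier) :
    A.monomial S = A.e (S 0) * A.monomial (Fin.tail S) :=
  ExteriorAlgebra.ιMulti_succ_apply _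

theorem monomial_cons {p : ℕ} (H : A.carrier) (S : Fin p → A.carrier) :
    A.monomial (Fin.cons H S : Fin (p + 1) → A.carrier) = A.e H * A.monomial S := by
  rw [monomial_succ, Fin.cons_zero, Fin.tail_cons]

theorem monomial_comp_perm {p : ℕ} (S : Fin p → A.carrier) (σ : Equiv.Perm (Fin p)) :
    A.monomial (S ∘ σ) = Equiv.Perm.sign σ • A.monomial S :=
  AlternatingMap.map_perm (ExteriorAlgebra.ιMulti K p) (fun i => Finsupp.single (S i) (1 : K)) σ

theorem monomial_eq_list_prod {p : ℕ} (S : Fin p → A.carrier) :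
    A.monomial S = (List.ofFn fun i => A.e (S i)).prod :=
  ExteriorAlgebra.ιMulti_apply _

theorem e_mul_monomial_of_mem {p : ℕ} (S : Fin p → A.carrier) (i : Fin p) :
    A.e (S i) * A.monomial S = 0 := by
  rw [monomial_eq_list_prod]
  exact ExteriorAlgebra.ι_mul_prod_list (fun i => Finsupp.single (S i) (1 : K)) i

theorem e_mem (H : A.carrier) : A.e H ∈ ⋀[K]^1 (A.carrier →₀ K) := by
  rw [ExteriorAlgebra.exteriorPower, pow_one]
  exact ⟨_, rfl⟩

theorem e_mul_mem_exteriorPower (H : A.carrier) {n : ℕ} {x : A.Ext}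
    (hx : x ∈ ⋀[K]^n (A.carrier →₀ K)) : A.e H * x ∈ ⋀[K]^(n + 1) (A.carrier →₀ K) := by
  have h := SetLike.GradedMul.mul_mem (A := fun i : ℕ => ⋀[K]^i (A.carrier →₀ K))
    (A.e_mem H) hx
  rwa [add_comm] at h

theorem monomial_mem {p : ℕ} (S : Fin p → A.carrier) :
    A.monomial S ∈ ⋀[K]^p (A.carrier →₀ K) := by
  rw [← ExteriorAlgebra.ιMulti_span_fixedDegree]
  exact Submodule.subset_span ⟨_, rfl⟩

/-- The monomials of degree `n` span the component of degree `n`. -/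
theorem span_monomial (n : ℕ) :
    Submodule.span K (Set.range fun S : Fin n → A.carrier => A.monomial S) =
      ⋀[K]^n (A.carrier →₀ K) := by
  refine le_antisymm (Submodule.span_le.2 ?_) ?_
  · rintro _ ⟨S, rfl⟩
    exact monomial_mem S
  · rw [ExteriorAlgebra.exteriorPower, range_ι_eq_span_e, Submodule.span_pow, Submodule.span_le]
    intro x hx
    obtain ⟨f, rfl⟩ := Set.mem_pow.1 hx
    choose S hS using fun i => (f i).2
    refine Submodule.subset_span ⟨S, ?_⟩
    simp only [monomial_eq_list_prod, hS]

theorem boundary_e_mul' (H : A.carrier) (x : A.Ext) :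
    A.boundary (A.e H * x) = x - A.e H * A.boundary x := A.boundary_e_mul H x

theorem boundary_boundary (x : A.Ext) : A.boundary (A.boundary x) = 0 :=
  CliffordAlgebra.contractLeft_contractLeft
    (Q := (0 : QuadraticForm K (A.carrier →₀ K)))
    (d := Finsupp.linearCombination K fun _ => (1 : K)) x

theorem boundary_monomial_mem {p : ℕ} (S : Fin (p + 1) → A.carrier) :
    A.boundary (A.monomial S) ∈ ⋀[K]^p (A.carrier →₀ K) := by
  induction p with
  | zero =>
    rw [monomial_succ, boundary_e_mul', monomial_zero, boundary_one, mul_zero, sub_zero]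
    exact SetLike.GradedOne.one_mem (A := fun i : ℕ => ⋀[K]^i (A.carrier →₀ K))
  | succ p ih =>
    rw [monomial_succ, boundary_e_mul']
    exact sub_mem (monomial_mem _) (e_mul_mem_exteriorPower _ (ih _))

theorem boundary_mem {p : ℕ} {x : A.Ext} (hx : x ∈ ⋀[K]^(p + 1) (A.carrier →₀ K)) :
    A.boundary x ∈ ⋀[K]^p (A.carrier →₀ K) := by
  rw [← span_monomial] at hx
  have : Submodule.span K (Set.range fun S : Fin (p + 1) → A.carrier => A.monomial S) ≤
      (⋀[K]^p (A.carrier →₀ K)).comap A.boundary := by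
    rw [Submodule.span_le]
    rintro _ ⟨S, rfl⟩
    exact boundary_monomial_mem S
  exact this hx

theorem mul_e_eq {n : ℕ} {x : A.Ext} (hx : x ∈ ⋀[K]^n (A.carrier →₀ K)) (H : A.carrier) :
    x * A.e H = (-1 : K) ^ n • (A.e H * x) := by
  rw [← span_monomial] at hx
  induction hx using Submodule.span_induction with
  | zero => simp
  | add x y _ _ hx hy => rw [add_mul, hx, hy, mul_add, smul_add]
  | smul c x _ hx => rw [smul_mul_assoc, hx, mul_smul_comm, smul_comm]
  | mem x hx =>
    obtain ⟨S, rfl⟩ := hx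
    change A.monomial S * _ = _ • (_ * A.monomial S)
    induction n with
    | zero => simp [monomial_zero]
    | succ n ih =>
      rw [monomial_succ, mul_assoc, ih, mul_smul_comm, e_mul_e_mul_comm, pow_succ, mul_smul]
      simp

/-! ### The Orlik–Solomon ideal -/

theorem pos_of_isDependent {p : ℕ} {S : Fin p → A.carrier} (hS : A.IsDependent S) : 0 < p :=
  lt_of_le_of_lt (Nat.zero_le _) hS

theorem isDependent_comp_perm {p : ℕ} {S : Fin p → A.carrier} (hS : A.IsDependent S)
    (σ : Equiv.Perm (Fin p)) : A.IsDependent (S ∘ σ) := by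
  have : ⨅ i, ((S ∘ σ) i : Submodule K V) = ⨅ i, (S i : Submodule K V) :=
    σ.iInf_comp (g := fun i => (S i : Submodule K V))
  rw [IsDependent, this]
  exact hS

variable (A) in
/-- The Orlik–Solomon ideal, as the left ideal generated by the elements `∂ e_S`, for `S`
dependent. -/
noncomputable def relIdeal : Ideal A.Ext :=
  Ideal.span {x | ∃ (p : ℕ) (S : Fin p → A.carrier),
    A.IsDependent S ∧ x = A.boundary (A.monomial S)}

theorem boundary_monomial_mem_relIdeal {p : ℕ} {S : Fin p → A.carrier} (hS : A.IsDependent S) :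
    A.boundary (A.monomial S) ∈ A.relIdeal :=
  Ideal.subset_span ⟨p, S, hS, rfl⟩

theorem relIdeal_smul_mem (c : K) {x : A.Ext} (hx : x ∈ A.relIdeal) : c • x ∈ A.relIdeal := by
  rw [Algebra.smul_def]
  exact A.relIdeal.mul_mem_left _ hx

/-- A subspace that contains the elements `∂ e_S`, for `S` dependent, and is stable under left
multiplication by the generators contains the Orlik–Solomon ideal. -/
theorem mem_of_mem_relIdeal (N : Submodule K A.Ext)
    (gen : ∀ (p : ℕ) (S : Fin p → A.carrier), A.IsDependent S → A.boundary (A.monomial S) ∈ N)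
    (e_mul : ∀ H, ∀ x ∈ N, A.e H * x ∈ N) {x : A.Ext} (hx : x ∈ A.relIdeal) : x ∈ N := by
  induction hx using Submodule.span_induction with
  | zero => exact N.zero_mem
  | add x y _ _ hx hy => exact N.add_mem hx hy
  | smul a x _ hx => exact mul_mem_of_e_mul_mem N e_mul a hx
  | mem x hx =>
    obtain ⟨p, S, hS, rfl⟩ := hx
    exact gen p S hS

variable (A) in
/-- The Orlik–Solomon ideal as a subspace. -/
noncomputable def relSubmodule : Submodule K A.Ext := A.relIdeal.restrictScalars K

/-- The generators ∂ e_S are homogeneous, so they commute with e_H up to sign. This is why the left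
ideal is already two-sided, and why later membership proofs need only left multiplications. -/
theorem mul_e_mem_relIdeal {x : A.Ext} (hx : x ∈ A.relIdeal) (H : A.carrier) :
    x * A.e H ∈ A.relIdeal := by
  refine mem_of_mem_relIdeal (A.relSubmodule.comap (LinearMap.mulRight K (A.e H))) ?_ ?_ hx
  · intro p S hS
    obtain ⟨p, rfl⟩ := Nat.exists_eq_succ_of_ne_zero (pos_of_isDependent hS).ne'
    change _ * _ ∈ A.relIdeal
    rw [mul_e_eq (boundary_monomial_mem S)]
    exact relIdeal_smul_mem _ (A.relIdeal.mul_mem_left _ (boundary_monomial_mem_relIdeal hS))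
  · intro L x hx
    change _ * _ * _ ∈ A.relIdeal
    rw [mul_assoc]
    exact A.relIdeal.mul_mem_left _ hx

instance isTwoSided_relIdeal : A.relIdeal.IsTwoSided where
  mul_mem_of_left {x} y hx := by
    have : y ∈ (A.relSubmodule.comap (LinearMap.mulLeft K x)) := by
      induction y using CliffordAlgebra.right_induction with
      | algebraMap r =>
        change x * _ ∈ A.relIdeal
        rw [← Algebra.commutes]
        exact A.relIdeal.mul_mem_left _ hx
      | add y z hy hz => exact add_mem hy hz
      | mul_ι v y hy =>
        have h : Submodule.span K (Set.range A.e) ≤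
            A.relSubmodule.comap (LinearMap.mulLeft K (x * y)) := by
          rw [Submodule.span_le]
          rintro _ ⟨H, rfl⟩
          exact mul_e_mem_relIdeal hy H
        have := h (ι_mem_span_e v)
        change x * (y * _) ∈ A.relIdeal
        rw [← mul_assoc]
        exact this
    exact this

variable (A) in
/-- The projection from the exterior algebra to the Orlik–Solomon algebra. -/
noncomputable def proj : A.Ext →ₐ[K] A.OSAlgebra := RingQuot.mkAlgHom K A.OSRel

theorem proj_surjective : Function.Surjective A.proj := RingQuot.mkAlgHom_surjective K A.OSRel

theorem proj_e (H : A.carrier) : A.proj (A.e H) = A.gen H := rfl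

/-- Since `relIdeal` is two-sided, the quotient by it is a ring in which the defining relations
hold, so the projection to it factors through `OSAlgebra`. -/
theorem proj_eq_zero_iff {x : A.Ext} : A.proj x = 0 ↔ x ∈ A.relIdeal := by
  constructor
  · intro h
    let f : A.OSAlgebra →ₐ[K] A.Ext ⧸ A.relIdeal :=
      RingQuot.liftAlgHom K ⟨Ideal.Quotient.mkₐ K A.relIdeal, by
        rintro x y ⟨p, S, hS, rfl, rfl⟩
        rw [map_zero]
        exact Ideal.Quotient.eq_zero_iff_mem.2 (boundary_monomial_mem_relIdeal hS)⟩
    have h1 : f (A.proj x) = Ideal.Quotient.mkₐ K A.relIdeal x :=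
      RingQuot.liftAlgHom_mkAlgHom_apply _ _ _ _
    rw [h, map_zero] at h1
    exact Ideal.Quotient.eq_zero_iff_mem.1 h1.symm
  · intro h
    refine mem_of_mem_relIdeal (LinearMap.ker A.proj.toLinearMap) ?_ ?_ h
    · intro p S hS
      have := RingQuot.mkAlgHom_rel K (s := A.OSRel) ⟨p, S, hS, rfl, rfl⟩
      rw [map_zero] at this
      exact this
    · intro H x hx
      have hx' : A.proj x = 0 := hx
      change A.proj _ = 0
      rw [map_mul, hx', mul_zero]

/-- A linear map on the exterior algebra that kills the Orlik–Solomon ideal descends to the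
Orlik–Solomon algebra. -/
noncomputable def descend {M : Type*} [AddCommGroup M] [Module K M] (f : A.Ext →ₗ[K] M)
    (hf : ∀ x ∈ A.relIdeal, f x = 0) : A.OSAlgebra →ₗ[K] M :=
  (Submodule.liftQ (LinearMap.ker A.proj.toLinearMap) f fun x hx => hf x (proj_eq_zero_iff.1 hx)) ∘ₗ
    (A.proj.toLinearMap.quotKerEquivOfSurjective proj_surjective).symm.toLinearMap

@[simp]
theorem descend_proj {M : Type*} [AddCommGroup M] [Module K M] (f : A.Ext →ₗ[K] M)
    (hf : ∀ x ∈ A.relIdeal, f x = 0) (x : A.Ext) : descend f hf (A.proj x) = f x := by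
  have h : (A.proj.toLinearMap.quotKerEquivOfSurjective proj_surjective).symm (A.proj x) =
      Submodule.Quotient.mk x := by
    rw [LinearEquiv.symm_apply_eq]
    rfl
  rw [descend, LinearMap.comp_apply, LinearEquiv.coe_coe, h]
  rfl

/-- Apply ∂ to e_{H₁} e_S = 0: the Leibniz rule gives e_S = e_{H₁} ∂ e_S. -/
theorem monomial_mem_relIdeal {p : ℕ} {S : Fin p → A.carrier} (hS : A.IsDependent S) :
    A.monomial S ∈ A.relIdeal := by
  have h := A.boundary_e_mul' (S ⟨0, pos_of_isDependent hS⟩) (A.monomial S)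
  rw [e_mul_monomial_of_mem, map_zero] at h
  rw [sub_eq_zero.1 h.symm]
  exact A.relIdeal.mul_mem_left _ (boundary_monomial_mem_relIdeal hS)

theorem boundary_mem_relIdeal {x : A.Ext} (hx : x ∈ A.relIdeal) : A.boundary x ∈ A.relIdeal := by
  -- The Leibniz rule for ∂(e_H x) returns x as well as e_H ∂x, so membership of x is carried along.
  have : x ∈ A.relSubmodule ⊓ A.relSubmodule.comap A.boundary := by
    refine mem_of_mem_relIdeal _ ?_ ?_ hx
    · intro p S hS
      refine ⟨boundary_monomial_mem_relIdeal hS, ?_⟩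
      change A.boundary _ ∈ A.relIdeal
      rw [boundary_boundary]
      exact zero_mem _
    · rintro H x ⟨hx, hx'⟩
      refine ⟨A.relIdeal.mul_mem_left _ hx, ?_⟩
      change A.boundary _ ∈ A.relIdeal
      rw [boundary_e_mul']
      exact sub_mem hx (A.relIdeal.mul_mem_left _ hx')
  exact this.2

theorem isHomogeneous_relIdeal :
    A.relIdeal.IsHomogeneous fun i : ℕ => ⋀[K]^i (A.carrier →₀ K) := by
  refine Ideal.homogeneous_span _ _ ?_
  rintro _ ⟨p, S, hS, rfl⟩
  obtain ⟨p, rfl⟩ := Nat.exists_eq_succ_of_ne_zero (pos_of_isDependent hS).ne'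
  exact ⟨p, boundary_monomial_mem S⟩

end CentralArrangement

/-! ### Codimension -/

namespace Submodule

variable {K : Type*} {V : Type*} [Field K] [AddCommGroup V] [Module K V] [FiniteDimensional K V]

theorem finrank_quotient_le_of_le {X Y : Submodule K V} (h : X ≤ Y) :
    Module.finrank K (V ⧸ Y) ≤ Module.finrank K (V ⧸ X) := by
  have h1 := X.finrank_quotient_add_finrank
  have h2 := Y.finrank_quotient_add_finrank
  have h3 := finrank_mono h
  omega

theorem finrank_quotient_lt_of_lt {X Y : Submodule K V} (h : X < Y) :
    Module.finrank K (V ⧸ Y) < Module.finrank K (V ⧸ X) := by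
  have h1 := X.finrank_quotient_add_finrank
  have h2 := Y.finrank_quotient_add_finrank
  have h3 := finrank_lt_finrank_of_lt h
  omega

theorem eq_of_le_of_finrank_quotient_le {X Y : Submodule K V} (h : X ≤ Y)
    (h' : Module.finrank K (V ⧸ X) ≤ Module.finrank K (V ⧸ Y)) : X = Y := by
  by_contra hne
  exact absurd (finrank_quotient_lt_of_lt (lt_of_le_of_ne h hne)) (not_lt.2 h')

/-- One unit of codimension is spent on H itself. This translates dependence of (H₀, T) in V into
dependence of the traces of T in H₀, and back. -/
theorem finrank_quotient_inf_of_isCoatom {H : Submodule K V} (hH : IsCoatom H)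
    (Y : Submodule K V) :
    Module.finrank K (V ⧸ H ⊓ Y) = Module.finrank K (H ⧸ Y.comap H.subtype) + 1 := by
  have h1 := (H ⊓ Y).finrank_quotient_add_finrank
  have h2 := (Y.comap H.subtype).finrank_quotient_add_finrank
  have h3 : Module.finrank K (Y.comap H.subtype) = Module.finrank K (H ⊓ Y : Submodule K V) := by
    rw [← finrank_map_subtype_eq, map_comap_subtype]
  have h4 := H.finrank_quotient_add_finrank
  have h5 : Module.finrank K (V ⧸ H) = 1 :=
    isSimpleModule_iff_finrank_eq_one.1 (isSimpleModule_iff_isCoatom.2 hH)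
  omega

theorem finrank_quotient_comap_subtype_le (X Y : Submodule K V) :
    Module.finrank K (X ⧸ Y.comap X.subtype) ≤ Module.finrank K (V ⧸ Y) := by
  refine LinearMap.finrank_le_finrank_of_injective
    (f := (Y.comap X.subtype).mapQ Y X.subtype le_rfl) ?_
  rw [← LinearMap.ker_eq_bot, ker_mapQ, mkQ_map_self]

theorem finrank_quotient_iInf_le {p : ℕ} {S : Fin p → Submodule K V} (hS : ∀ i, IsCoatom (S i)) :
    Module.finrank K (V ⧸ ⨅ i, S i) ≤ p := by
  induction p with
  | zero =>
    have h := (⨅ i, S i).finrank_quotient_add_finrank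
    rw [iInf_of_empty, finrank_top] at h
    rw [iInf_of_empty]
    omega
  | succ p ih =>
    have h : ⨅ i, S i = S 0 ⊓ ⨅ i : Fin p, S i.succ :=
      le_antisymm (le_inf (iInf_le _ _) (le_iInf fun _ => iInf_le _ _))
        (le_iInf fun i => Fin.cases inf_le_left (fun i => inf_le_of_right_le (iInf_le _ i)) i)
    rw [h, finrank_quotient_inf_of_isCoatom (hS 0)]
    exact Nat.succ_le_succ ((finrank_quotient_comap_subtype_le _ _).trans (ih fun i => hS _))

end Submodule

namespace CentralArrangement

variable {K : Type u} {V W : Type v} [Field K] [AddCommGroup V] [Module K V]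
  [AddCommGroup W] [Module K W]

/-! ### Homomorphisms of exterior algebras induced by maps of hyperplanes -/

section Transfer

variable (A : CentralArrangement K V) (B : CentralArrangement K W)
  (r : Submodule K V → Submodule K W)

open Classical in
/-- The algebra homomorphism `E(A) → E(B)` that sends `e_H` to `e_{r H}` if `r H ∈ B`, and to `0`
otherwise. -/
noncomputable def transfer : A.Ext →ₐ[K] B.Ext :=
  ExteriorAlgebra.map (Finsupp.linearCombination K fun H : A.carrier =>
    if h : r H ∈ B.carrier then Finsupp.single ⟨r H, h⟩ (1 : K) else 0)

variable {A B r}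

theorem transfer_e_of_mem {H : A.carrier} (h : r H ∈ B.carrier) :
    transfer A B r (A.e H) = B.e ⟨r H, h⟩ := by
  simp [transfer, e, ExteriorAlgebra.map_apply_ι, h]

theorem transfer_e_of_notMem {H : A.carrier} (h : r H ∉ B.carrier) :
    transfer A B r (A.e H) = 0 := by
  simp [transfer, e, ExteriorAlgebra.map_apply_ι, h]

theorem transfer_monomial {p : ℕ} {S : Fin p → A.carrier} (h : ∀ i, r (S i) ∈ B.carrier) :
    transfer A B r (A.monomial S) = B.monomial fun i => ⟨r (S i), h i⟩ := by
  rw [monomial_eq_list_prod, monomial_eq_list_prod, map_list_prod, List.map_ofFn]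
  congr 2
  exact funext fun i => transfer_e_of_mem (h i)

theorem transfer_monomial_eq_zero {p : ℕ} {S : Fin p → A.carrier} {i : Fin p}
    (h : r (S i) ∉ B.carrier) : transfer A B r (A.monomial S) = 0 := by
  rw [monomial_eq_list_prod, map_list_prod, List.map_ofFn]
  exact List.prod_eq_zero (List.mem_ofFn.2 ⟨i, transfer_e_of_notMem h⟩)

theorem transfer_boundary_monomial {p : ℕ} {S : Fin p → A.carrier}
    (h : ∀ i, r (S i) ∈ B.carrier) :
    transfer A B r (A.boundary (A.monomial S)) =
      B.boundary (B.monomial fun i => ⟨r (S i), h i⟩) := by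
  induction p with
  | zero => rw [monomial_zero, monomial_zero, boundary_one, boundary_one, map_zero]
  | succ p ih =>
    rw [monomial_succ, monomial_succ, boundary_e_mul', boundary_e_mul', map_sub, map_mul,
      transfer_e_of_mem (h 0), ih (S := Fin.tail S) fun i => h i.succ,
      transfer_monomial (S := Fin.tail S) fun i => h i.succ]
    rfl

/-- No generator may be killed: if e_H ↦ 0, then ∂ e_H = 1 would still map to 1, not to ∂ 0 = 0. -/
theorem transfer_boundary (h : ∀ H ∈ A.carrier, r H ∈ B.carrier) (x : A.Ext) :
    transfer A B r (A.boundary x) = B.boundary (transfer A B r x) := by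
  have : x ∈ LinearMap.eqLocus ((transfer A B r).toLinearMap ∘ₗ A.boundary)
      (B.boundary ∘ₗ (transfer A B r).toLinearMap) := by
    refine mem_of_e_mul_mem _ ?_ ?_ x
    · simp [boundary_one]
    · intro H y hy
      have hy' : transfer A B r (A.boundary y) = B.boundary (transfer A B r y) := hy
      change transfer A B r (A.boundary _) = B.boundary (transfer A B r _)
      rw [boundary_e_mul', map_sub, map_mul, map_mul, transfer_e_of_mem (h H H.2),
        boundary_e_mul', hy']
  exact this

theorem transfer_mem_exteriorPower {n : ℕ} {x : A.Ext} (hx : x ∈ ⋀[K]^n (A.carrier →₀ K)) :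
    transfer A B r x ∈ ⋀[K]^n (B.carrier →₀ K) := by
  have : Submodule.span K (Set.range fun S : Fin n → A.carrier => A.monomial S) ≤
      (⋀[K]^n (B.carrier →₀ K)).comap (transfer A B r).toLinearMap := by
    rw [Submodule.span_le]
    rintro _ ⟨S, rfl⟩
    change transfer A B r (A.monomial S) ∈ ⋀[K]^n (B.carrier →₀ K)
    by_cases h : ∀ i, r (S i) ∈ B.carrier
    · rw [transfer_monomial h]
      exact monomial_mem _
    · obtain ⟨i, hi⟩ := not_forall.1 h
      rw [transfer_monomial_eq_zero hi]
      exact zero_mem _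
  rw [← span_monomial] at hx
  exact this hx

theorem transfer_mem_relIdeal
    (gen : ∀ (p : ℕ) (S : Fin p → A.carrier), A.IsDependent S →
      transfer A B r (A.boundary (A.monomial S)) ∈ B.relIdeal)
    {x : A.Ext} (hx : x ∈ A.relIdeal) : transfer A B r x ∈ B.relIdeal := by
  refine mem_of_mem_relIdeal (B.relSubmodule.comap (transfer A B r).toLinearMap) gen ?_ hx
  intro H x hx
  change transfer A B r _ ∈ B.relIdeal
  rw [map_mul]
  exact B.relIdeal.mul_mem_left _ hx

theorem decompose_transfer (x : A.Ext) (n : ℕ) :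
    (DirectSum.decompose (fun i : ℕ => ⋀[K]^i (B.carrier →₀ K)) (transfer A B r x) n : B.Ext) =
      transfer A B r (DirectSum.decompose (fun i : ℕ => ⋀[K]^i (A.carrier →₀ K)) x n) := by
  induction x using DirectSum.Decomposition.inductionOn fun i : ℕ => ⋀[K]^i (A.carrier →₀ K) with
  | zero => simp
  | add x y hx hy =>
    rw [map_add, DirectSum.decompose_add, DirectSum.decompose_add, DirectSum.add_apply,
      DirectSum.add_apply, Submodule.coe_add, Submodule.coe_add, map_add, hx, hy]
  | homogeneous x =>
    rename_i i
    obtain rfl | hin := eq_or_ne i n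
    · rw [DirectSum.decompose_of_mem_same
        (fun i : ℕ => ⋀[K]^i (B.carrier →₀ K)) (transfer_mem_exteriorPower x.2),
        DirectSum.decompose_of_mem_same (fun i : ℕ => ⋀[K]^i (A.carrier →₀ K)) x.2]
    · rw [DirectSum.decompose_of_mem_ne
        (fun i : ℕ => ⋀[K]^i (B.carrier →₀ K)) (transfer_mem_exteriorPower x.2) hin,
        DirectSum.decompose_of_mem_ne (fun i : ℕ => ⋀[K]^i (A.carrier →₀ K)) x.2 hin, map_zero]

theorem algHom_eq_of_apply_e {R : Type*} [Ring R] [Algebra K R] {f g : A.Ext →ₐ[K] R}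
    (h : ∀ H, f (A.e H) = g (A.e H)) : f = g := by
  refine ExteriorAlgebra.hom_ext (Finsupp.lhom_ext' fun H => LinearMap.ext_ring ?_)
  exact h H

end Transfer

/-! ### Localization and the decomposition of each degree by subspaces -/

variable {A B : CentralArrangement K V}

theorem transfer_id_mem_relIdeal (hBA : B.carrier ⊆ A.carrier) {x : B.Ext} (hx : x ∈ B.relIdeal) :
    transfer B A id x ∈ A.relIdeal := by
  refine transfer_mem_relIdeal (fun p S hS => ?_) hx
  rw [transfer_boundary_monomial fun i => hBA (S i).2]
  exact boundary_monomial_mem_relIdeal hS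

theorem exists_monomial_eq_smul_cons {p : ℕ} (S : Fin (p + 1) → A.carrier) (k : Fin (p + 1)) :
    ∃ (T : Fin p → A.carrier) (c : ℤˣ),
      A.monomial S = c • A.monomial (Fin.cons (S k) T : Fin (p + 1) → A.carrier) ∧
      (A.IsDependent S → A.IsDependent (Fin.cons (S k) T : Fin (p + 1) → A.carrier)) := by
  have h : (Fin.cons (S k) (Fin.tail (S ∘ Equiv.swap 0 k)) : Fin (p + 1) → A.carrier) =
      S ∘ Equiv.swap 0 k := by
    conv_rhs => rw [← Fin.cons_self_tail (S ∘ Equiv.swap 0 k)]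
    simp
  refine ⟨Fin.tail (S ∘ Equiv.swap 0 k), Equiv.Perm.sign (Equiv.swap 0 k), ?_, fun hS => ?_⟩
  · rw [h, monomial_comp_perm, smul_smul, Int.units_mul_self, one_smul]
  · rw [h]
    exact isDependent_comp_perm hS _

theorem iInf_cons {p : ℕ} (H : A.carrier) (T : Fin p → A.carrier) :
    ⨅ i, ((Fin.cons H T : Fin (p + 1) → A.carrier) i : Submodule K V) =
      (H : Submodule K V) ⊓ ⨅ i, (T i : Submodule K V) :=
  le_antisymm (le_inf (iInf_le _ 0) (le_iInf fun i => iInf_le_of_le i.succ le_rfl))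
    (le_iInf fun i => Fin.cases inf_le_left (fun i => inf_le_of_right_le (iInf_le _ i)) i)

theorem units_smul_mem_relIdeal (c : ℤˣ) {x : A.Ext} (hx : x ∈ A.relIdeal) :
    c • x ∈ A.relIdeal := by
  obtain rfl | rfl := Int.units_eq_one_or c
  · simpa using hx
  · simpa using hx

/-- The localization `A_X = {H ∈ A | X ⊆ H}`. -/
def localization (A : CentralArrangement K V) (X : Submodule K V) : CentralArrangement K V where
  carrier := {H | H ∈ A.carrier ∧ X ≤ H}
  finite_carrier := A.finite_carrier.subset fun _ hH => hH.1
  isCoatom_of_mem H hH := A.isCoatom_of_mem H hH.1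

theorem mem_localization {X : Submodule K V} {H : A.carrier} :
    id (H : Submodule K V) ∈ (A.localization X).carrier ↔ X ≤ H :=
  ⟨fun h => h.2, fun h => ⟨H.2, h⟩⟩

variable [FiniteDimensional K V]

/-- If some H_k in a dependent S does not contain X, move it to the front: ∂(e_{H_k} e_T) = e_T -
e_{H_k} ∂ e_T, and the second term dies. If e_T survives, all of T contains X but H_k does not, so
dropping H_k strictly lowers the codimension and T is still dependent. -/
theorem transfer_localization_mem_relIdeal (X : Submodule K V) {x : A.Ext}
    (hx : x ∈ A.relIdeal) : transfer A (A.localization X) id x ∈ (A.localization X).relIdeal := by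
  refine transfer_mem_relIdeal (fun p S hS => ?_) hx
  by_cases h : ∀ i, X ≤ (S i : Submodule K V)
  · rw [transfer_boundary_monomial fun i => mem_localization.2 (h i)]
    exact boundary_monomial_mem_relIdeal hS
  obtain ⟨k, hk⟩ := not_forall.1 h
  obtain ⟨p, rfl⟩ := Nat.exists_eq_succ_of_ne_zero (pos_of_isDependent hS).ne'
  obtain ⟨T, c, h1, h2⟩ := exists_monomial_eq_smul_cons S k
  have hT := h2 hS
  rw [h1, Units.smul_def, map_zsmul, map_zsmul, ← Units.smul_def, monomial_cons, boundary_e_mul',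
    map_sub, map_mul, transfer_e_of_notMem (mt mem_localization.1 hk), zero_mul, sub_zero]
  refine units_smul_mem_relIdeal _ ?_
  by_cases h' : ∀ i, X ≤ (T i : Submodule K V)
  · rw [transfer_monomial fun i => mem_localization.2 (h' i)]
    refine monomial_mem_relIdeal ?_
    change Module.finrank K (V ⧸ ⨅ i, (T i : Submodule K V)) < p
    have hlt : (S k : Submodule K V) ⊓ ⨅ i, (T i : Submodule K V) < ⨅ i, (T i : Submodule K V) :=
      lt_of_le_of_ne inf_le_right fun h => hk ((le_iInf h').trans (inf_eq_right.1 h))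
    have := Submodule.finrank_quotient_lt_of_lt hlt
    rw [IsDependent, iInf_cons] at hT
    omega
  · obtain ⟨i, hi⟩ := not_forall.1 h'
    rw [transfer_monomial_eq_zero (mt mem_localization.1 hi)]
    exact zero_mem _

/-- Modulo the Orlik–Solomon ideal, an element of degree `n` is the sum of its localizations at
finitely many subspaces of codimension at most `n`. -/
theorem exists_sub_sum_localization_mem_relIdeal (A : CentralArrangement K V) (n : ℕ) :
    ∃ F : Finset (Submodule K V), (∀ X ∈ F, Module.finrank K (V ⧸ X) ≤ n) ∧
      ∀ x ∈ ⋀[K]^n (A.carrier →₀ K),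
        x - ∑ X ∈ F, transfer (A.localization X) A id (transfer A (A.localization X) id x) ∈
          A.relIdeal := by
  classical
  have := A.finite_carrier.to_subtype
  have hF : (Set.range fun S : Fin n → A.carrier => ⨅ i, (S i : Submodule K V)).Finite :=
    Set.finite_range _
  have hloc (X) : (A.localization X).carrier ⊆ A.carrier := fun H hH => hH.1
  have hcodim : ∀ X ∈ hF.toFinset, Module.finrank K (V ⧸ X) ≤ n := by
    intro X hX
    obtain ⟨S, rfl⟩ := hF.mem_toFinset.1 hX
    exact Submodule.finrank_quotient_iInf_le fun i => A.isCoatom_of_mem _ (S i).2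
  refine ⟨hF.toFinset, hcodim, fun x hx => ?_⟩
  let f : A.Ext →ₗ[K] A.Ext := LinearMap.id - ∑ X ∈ hF.toFinset,
    (transfer (A.localization X) A id).toLinearMap ∘ₗ
      (transfer A (A.localization X) id).toLinearMap
  have hf (y : A.Ext) : f y = y - ∑ X ∈ hF.toFinset,
      transfer (A.localization X) A id (transfer A (A.localization X) id y) := by
    simp [f]
  rw [← hf]
  have : Submodule.span K (Set.range fun S : Fin n → A.carrier => A.monomial S) ≤
      A.relSubmodule.comap f := by
    rw [Submodule.span_le]
    rintro _ ⟨S, rfl⟩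
    change f _ ∈ A.relIdeal
    rw [hf]
    by_cases hS : A.IsDependent S
    · have h := monomial_mem_relIdeal hS
      refine sub_mem h (sum_mem fun X _ => ?_)
      exact transfer_id_mem_relIdeal (hloc X) (transfer_localization_mem_relIdeal X h)
    -- An independent monomial survives only in localizations at X ≤ ⋂ Sᵢ. As codim X ≤ n ≤ codim ⋂
    -- Sᵢ, only X = ⋂ Sᵢ remains, and there it is reproduced exactly.
    · rw [Finset.sum_eq_single (⨅ i, (S i : Submodule K V))]
      · rw [transfer_monomial fun i => mem_localization.2 (iInf_le _ i),
          transfer_monomial fun i => (S i).2]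
        simp
      · intro X hX hne
        by_cases hXS : ∀ i, X ≤ (S i : Submodule K V)
        · exact absurd (Submodule.eq_of_le_of_finrank_quotient_le (le_iInf hXS)
            ((hcodim X hX).trans (not_lt.1 hS))) hne
        · obtain ⟨i, hi⟩ := not_forall.1 hXS
          rw [transfer_monomial_eq_zero (mt mem_localization.1 hi), map_zero]
      · exact fun h => absurd (hF.mem_toFinset.2 ⟨S, rfl⟩) h
  rw [← span_monomial] at hx
  exact this hx

/-! ### Small degrees -/

theorem ne_one_of_isDependent {p : ℕ} {S : Fin p → A.carrier} (hS : A.IsDependent S) : p ≠ 1 := by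
  rintro rfl
  have h1 : Module.finrank K (V ⧸ ⨅ i, (S i : Submodule K V)) < 1 := hS
  rw [ciInf_unique] at h1
  have h2 := Submodule.finrank_quotient_lt_of_lt (A.isCoatom_of_mem _ (S default).2).lt_top
  omega

theorem eq_of_isDependent_two {S : Fin 2 → A.carrier} (hS : A.IsDependent S) : S 0 = S 1 := by
  by_contra hne
  have hS' : Module.finrank K (V ⧸ ⨅ i, (S i : Submodule K V)) < 2 := hS
  have h0 := A.isCoatom_of_mem _ (S 0).2
  have h1 := A.isCoatom_of_mem _ (S 1).2
  have hlt : ⨅ i, (S i : Submodule K V) < S 0 := by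
    refine lt_of_le_of_ne (iInf_le _ _) fun h => hne (Subtype.ext ?_)
    have hle : (S 0 : Submodule K V) ≤ S 1 := h ▸ iInf_le _ 1
    exact (hle.lt_or_eq.resolve_left fun hlt => h1.1 (h0.2 _ hlt))
  have h2 := Submodule.finrank_quotient_lt_of_lt hlt
  have h3 := Submodule.finrank_quotient_lt_of_lt h0.lt_top
  omega

/-- All relations live in degree at least 2: a single hyperplane is never dependent, and a dependent
pair has equal entries, so its monomial is 0. Truncating above degree 1 therefore shows that 1 and
the a_H satisfy no linear relation. -/
theorem toTrivSqZeroExt_eq_zero {x : A.Ext} (hx : x ∈ A.relIdeal) :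
    ExteriorAlgebra.toTrivSqZeroExt x = 0 := by
  refine mem_of_mem_relIdeal (LinearMap.ker
    (ExteriorAlgebra.toTrivSqZeroExt : A.Ext →ₐ[K] _).toLinearMap) ?_ ?_ hx
  · intro p S hS
    have he (H L : A.carrier) (y : A.Ext) :
        ExteriorAlgebra.toTrivSqZeroExt (A.e H * (A.e L * y)) = 0 := by
      rw [← mul_assoc, map_mul, map_mul, e, e, ExteriorAlgebra.toTrivSqZeroExt_ι,
        ExteriorAlgebra.toTrivSqZeroExt_ι, TrivSqZeroExt.inr_mul_inr, zero_mul]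
    change ExteriorAlgebra.toTrivSqZeroExt (A.boundary (A.monomial S)) = 0
    match p, S, hS with
    | 0, S, hS => exact absurd (pos_of_isDependent hS) (lt_irrefl _)
    | 1, S, hS => exact absurd rfl (ne_one_of_isDependent hS)
    | 2, S, hS =>
      have : A.monomial S = 0 := by
        rw [monomial_succ, monomial_succ, ← mul_assoc, eq_of_isDependent_two hS]
        change A.e (S 1) * A.e (S 1) * _ = 0
        rw [e_mul_self, zero_mul]
      rw [this, map_zero, map_zero]
    | p + 3, S, hS =>
      rw [monomial_succ, monomial_succ, monomial_succ, boundary_e_mul', boundary_e_mul',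
        boundary_e_mul', mul_sub, map_sub, map_sub, he, he, mul_sub, mul_sub, map_sub, he, he]
      simp
  · intro H y hy
    have hy' : ExteriorAlgebra.toTrivSqZeroExt y = 0 := hy
    change ExteriorAlgebra.toTrivSqZeroExt _ = 0
    rw [map_mul, hy', mul_zero]

theorem eq_zero_of_smul_one_mem_relIdeal {c : K} (hc : c • (1 : A.Ext) ∈ A.relIdeal) : c = 0 := by
  have h := congrArg TrivSqZeroExt.fst (toTrivSqZeroExt_eq_zero hc)
  simpa using h

/-! ### Injectivity of the inclusion of a subarrangement -/

/-- Both arrangements are quantified after the degree, because the induction hypothesis is applied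
to their localizations. -/
theorem mem_relIdeal_of_mem_of_transfer_mem (n : ℕ) :
    ∀ {A B : CentralArrangement K V}, B.carrier ⊆ A.carrier →
      ∀ x ∈ ⋀[K]^n (B.carrier →₀ K), transfer B A id x ∈ A.relIdeal → x ∈ B.relIdeal := by
  induction n with
  | zero =>
    intro A B _ x hx hxA
    rw [ExteriorAlgebra.exteriorPower, pow_zero] at hx
    obtain ⟨c, rfl⟩ := Submodule.mem_one.1 hx
    rw [Algebra.algebraMap_eq_smul_one, map_smul, map_one] at hxA
    rw [eq_zero_of_smul_one_mem_relIdeal hxA, map_zero]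
    exact zero_mem _
  | succ n ih =>
    intro A B hBA x hx hxA
    obtain ⟨F, hF, hsum⟩ := exists_sub_sum_localization_mem_relIdeal B (n + 1)
    rw [← sub_add_cancel x (∑ X ∈ F, transfer (B.localization X) B id
      (transfer B (B.localization X) id x))]
    refine add_mem (hsum x hx) (sum_mem fun X hX => ?_)
    refine transfer_id_mem_relIdeal (B := B.localization X) (fun H hH => hH.1) ?_
    set C := B.localization X
    set y := transfer B C id x with hy
    have hyn : y ∈ ⋀[K]^(n + 1) (C.carrier →₀ K) := transfer_mem_exteriorPower hx
    have hCA : C.carrier ⊆ (A.localization X).carrier := fun H hH => ⟨hBA hH.1, hH.2⟩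
    -- Localizing at X commutes with including the subarrangement, as a comparison on generators
    -- shows.
    have hyA : transfer C (A.localization X) id y ∈ (A.localization X).relIdeal := by
      have hcomp : (transfer C (A.localization X) id).comp (transfer B C id) =
          (transfer A (A.localization X) id).comp (transfer B A id) := by
        refine algHom_eq_of_apply_e fun H => ?_
        simp only [AlgHom.comp_apply]
        rw [transfer_e_of_mem (B := A) (r := id) (hBA H.2)]
        by_cases hH : X ≤ (H : Submodule K V)
        · rw [transfer_e_of_mem (mem_localization.2 hH), transfer_e_of_mem (r := id)
            (H := (⟨id (H : Submodule K V), hBA H.2⟩ : A.carrier)) (mem_localization.2 hH)]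
          exact transfer_e_of_mem (A := C) (r := id)
            (H := ⟨id (H : Submodule K V), mem_localization.2 hH⟩) (hCA (mem_localization.2 hH))
        · rw [transfer_e_of_notMem (mt mem_localization.1 hH), map_zero,
            transfer_e_of_notMem (r := id)
              (H := (⟨id (H : Submodule K V), hBA H.2⟩ : A.carrier)) (mt mem_localization.1 hH)]
      have := transfer_localization_mem_relIdeal X hxA
      rwa [← AlgHom.comp_apply, ← hcomp, AlgHom.comp_apply] at this
    have hdy : C.boundary y ∈ C.relIdeal := by
      refine ih hCA _ (boundary_mem hyn) ?_
      rw [transfer_boundary (r := id) fun H hH => hCA hH]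
      exact boundary_mem_relIdeal hyA
    -- Some H is needed to form e_H y; without any, the component of degree n + 1 > 0 is zero.
    obtain hC | ⟨⟨H⟩⟩ := isEmpty_or_nonempty C.carrier
    · rw [← span_monomial, Set.range_eq_empty, Submodule.span_empty] at hyn
      rw [(Submodule.mem_bot K).1 hyn]
      exact zero_mem _
    -- The hyperplanes of C all contain X, of codimension at most n + 1, so every (n + 2)-tuple of
    -- them is dependent.
    · have hey : C.e H * y ∈ C.relIdeal := by
        have h := e_mul_mem_exteriorPower H hyn
        rw [← span_monomial] at h
        refine (Submodule.span_le (p := C.relSubmodule)).2 ?_ h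
        rintro _ ⟨S, rfl⟩
        refine monomial_mem_relIdeal ?_
        have h1 := Submodule.finrank_quotient_le_of_le (le_iInf fun i => (S i).2.2)
        exact lt_of_le_of_lt (h1.trans (hF X hX)) (Nat.lt_succ_self _)
      have h := boundary_mem_relIdeal hey
      rw [boundary_e_mul'] at h
      simpa using add_mem h (C.relIdeal.mul_mem_left (C.e H) hdy)

theorem mem_relIdeal_of_transfer_mem (hBA : B.carrier ⊆ A.carrier) {x : B.Ext}
    (hx : transfer B A id x ∈ A.relIdeal) : x ∈ B.relIdeal := by
  rw [isHomogeneous_relIdeal.mem_iff] at hx ⊢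
  intro n
  refine mem_relIdeal_of_mem_of_transfer_mem n hBA _ (SetLike.coe_mem _) ?_
  rw [← decompose_transfer]
  exact hx n

end CentralArrangement

namespace CentralArrangement

variable {K : Type u} {V : Type v} [Field K] [AddCommGroup V] [Module K V]
variable {A B : CentralArrangement K V}

/-! ### Contraction with a coordinate form -/

/-- The antiderivation of `E(A)` with `e_{H₀} ↦ 1` and `e_H ↦ 0` for `H ≠ H₀`. -/
noncomputable def contract (H₀ : A.carrier) : A.Ext →ₗ[K] A.Ext :=
  CliffordAlgebra.contractLeft (Q := (0 : QuadraticForm K (A.carrier →₀ K))) (Finsupp.lapply H₀)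

theorem contract_one (H₀ : A.carrier) : contract H₀ (1 : A.Ext) = 0 :=
  CliffordAlgebra.contractLeft_one (Q := (0 : QuadraticForm K (A.carrier →₀ K))) _

theorem contract_boundary (H₀ : A.carrier) (x : A.Ext) :
    contract H₀ (A.boundary x) = -A.boundary (contract H₀ x) :=
  CliffordAlgebra.contractLeft_comm (Q := (0 : QuadraticForm K (A.carrier →₀ K))) _ _ x

theorem contract_e_mul_self (H₀ : A.carrier) (x : A.Ext) :
    contract H₀ (A.e H₀ * x) = x - A.e H₀ * contract H₀ x := by
  have h := CliffordAlgebra.contractLeft_ι_mul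
    (Q := (0 : QuadraticForm K (A.carrier →₀ K)))
    (d := Finsupp.lapply H₀) (Finsupp.single H₀ 1) x
  rw [Finsupp.lapply_apply, Finsupp.single_eq_same, one_smul] at h
  exact h

theorem contract_e_mul_of_ne {H₀ H : A.carrier} (hne : H ≠ H₀) (x : A.Ext) :
    contract H₀ (A.e H * x) = -(A.e H * contract H₀ x) := by
  have h := CliffordAlgebra.contractLeft_ι_mul
    (Q := (0 : QuadraticForm K (A.carrier →₀ K)))
    (d := Finsupp.lapply H₀) (Finsupp.single H 1) x
  rw [Finsupp.lapply_apply, Finsupp.single_eq_of_ne hne.symm, zero_smul, zero_sub] at h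
  exact h

theorem contract_monomial {p : ℕ} {H₀ : A.carrier} {S : Fin p → A.carrier}
    (hS : ∀ i, S i ≠ H₀) : contract H₀ (A.monomial S) = 0 := by
  induction p with
  | zero => rw [monomial_zero, contract_one]
  | succ p ih =>
    rw [monomial_succ, contract_e_mul_of_ne (hS 0), ih (S := Fin.tail S) fun i => hS i.succ,
      mul_zero, neg_zero]

/-! ### Deletion and restriction -/

/-- The algebra homomorphism `E(A) → E(A'')` that sends `e_H` to `e_{H''}` for `H ≠ H₀`, and
`e_{H₀}` to `0`. -/
noncomputable abbrev restrictExt (H₀ : A.carrier) : A.Ext →ₐ[K] (A.restriction H₀).Ext :=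
  transfer A (A.restriction H₀) (trace (H₀ : Submodule K V))

theorem deletion_subset (A : CentralArrangement K V) (H₀ : Submodule K V) :
    (A.deletion H₀).carrier ⊆ A.carrier := fun _ hH => hH.1

theorem trace_mem_restriction {H₀ H : A.carrier} (hne : H ≠ H₀) :
    trace (H₀ : Submodule K V) H ∈ (A.restriction H₀).carrier := by
  refine ⟨H, ⟨H.2, fun hle => hne ?_⟩, rfl⟩
  exact Subtype.ext ((hle.lt_or_eq.resolve_left fun hlt =>
    (A.isCoatom_of_mem H H.2).1 ((A.isCoatom_of_mem H₀ H₀.2).2 _ hlt)).symm)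

theorem trace_self_notMem_restriction (H₀ : A.carrier) :
    trace (H₀ : Submodule K V) H₀ ∉ (A.restriction H₀).carrier := by
  intro h
  refine ((A.restriction H₀).isCoatom_of_mem _ h).1 ?_
  exact Submodule.comap_subtype_self _

theorem iInf_trace {p : ℕ} (X : Submodule K V) (T : Fin p → Submodule K V) :
    ⨅ i, trace X (T i) = (⨅ i, T i).comap X.subtype :=
  (Submodule.comap_iInf _ _).symm

theorem contract_transfer_deletion (H₀ : A.carrier) (x : (A.deletion H₀).Ext) :
    contract H₀ (transfer (A.deletion H₀) A id x) = 0 := by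
  refine mem_of_e_mul_mem
    (LinearMap.ker (contract H₀ ∘ₗ (transfer (A.deletion H₀) A id).toLinearMap)) ?_ ?_ x
  · change contract H₀ (transfer (A.deletion H₀) A id 1) = 0
    rw [map_one, contract_one]
  · intro H y hy
    have hy' : contract H₀ (transfer (A.deletion H₀) A id y) = 0 := hy
    change contract H₀ (transfer (A.deletion H₀) A id (_ * y)) = 0
    rw [map_mul, transfer_e_of_mem (r := id) (deletion_subset A _ H.2),
      contract_e_mul_of_ne fun h => H.2.2 (congrArg Subtype.val h : (H : Submodule K V) = H₀),
      hy', mul_zero, neg_zero]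

/-- The sum E(𝒜') + e_{H₀} E(𝒜') contains 1 and is stable under every generator: e_{H₀} squares to
zero and anticommutes with the others. -/
theorem exists_eq_transfer_deletion_add (H₀ : A.carrier) (x : A.Ext) :
    ∃ y z : (A.deletion H₀).Ext, x = transfer (A.deletion H₀) A id y +
      A.e H₀ * transfer (A.deletion H₀) A id z := by
  have : x ∈ LinearMap.range (transfer (A.deletion H₀) A id).toLinearMap ⊔
      (LinearMap.range (transfer (A.deletion H₀) A id).toLinearMap).map
        (LinearMap.mulLeft K (A.e H₀)) := by
    refine mem_of_e_mul_mem _ (Submodule.mem_sup_left ?_) ?_ x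
    · exact ⟨1, map_one (transfer (A.deletion H₀) A id)⟩
    intro H w hw
    obtain ⟨_, ⟨y, rfl⟩, _, ⟨_, ⟨z, rfl⟩, rfl⟩, rfl⟩ := Submodule.mem_sup.1 hw
    simp only [AlgHom.toLinearMap_apply, LinearMap.mulLeft_apply]
    obtain rfl | hne := eq_or_ne H H₀
    · rw [mul_add, e_mul_e_mul_self, add_zero]
      exact Submodule.mem_sup_right ⟨_, ⟨y, rfl⟩, rfl⟩
    · have hH : (H : Submodule K V) ∈ (A.deletion H₀).carrier :=
        ⟨H.2, fun h => hne (Subtype.ext h)⟩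
      have he : transfer (A.deletion H₀) A id ((A.deletion H₀).e ⟨H, hH⟩) = A.e H :=
        transfer_e_of_mem (r := id) (H := ⟨(H : Submodule K V), hH⟩) H.2
      rw [mul_add, e_mul_e_mul_comm, ← he, ← map_mul, ← map_mul]
      refine add_mem (Submodule.mem_sup_left ⟨_, rfl⟩) (neg_mem (Submodule.mem_sup_right ?_))
      exact ⟨_, ⟨_, rfl⟩, rfl⟩
  obtain ⟨_, ⟨y, rfl⟩, _, ⟨_, ⟨z, rfl⟩, rfl⟩, rfl⟩ := Submodule.mem_sup.1 this
  exact ⟨y, z, rfl⟩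

theorem exists_section_trace (H₀ : A.carrier) :
    ∃ σ : Submodule K (H₀ : Submodule K V) → Submodule K V, ∀ L ∈ (A.restriction H₀).carrier,
      σ L ∈ (A.deletion H₀).carrier ∧ trace (H₀ : Submodule K V) (σ L) = L := by
  have (L : Submodule K (H₀ : Submodule K V)) : ∃ H : Submodule K V,
      L ∈ (A.restriction H₀).carrier →
        H ∈ (A.deletion H₀).carrier ∧ trace (H₀ : Submodule K V) H = L := by
    by_cases hL : L ∈ (A.restriction H₀).carrier
    · obtain ⟨H, ⟨hA, hH⟩, rfl⟩ := hL
      exact ⟨H, fun _ => ⟨⟨hA, fun h => hH h.ge⟩, rfl⟩⟩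
    -- A dummy value outside 𝒜''.
    · exact ⟨⊤, fun h => absurd h hL⟩
  choose σ hσ using this
  exact ⟨σ, hσ⟩

theorem transfer_trace_transfer_section {H₀ : A.carrier}
    {σ : Submodule K (H₀ : Submodule K V) → Submodule K V}
    (hσ : ∀ L ∈ (A.restriction H₀).carrier,
      σ L ∈ (A.deletion H₀).carrier ∧ trace (H₀ : Submodule K V) (σ L) = L)
    (y : (A.restriction H₀).Ext) :
    restrictExt H₀ (transfer (A.restriction H₀) A σ y) = y := by
  have : (restrictExt H₀).comp (transfer (A.restriction H₀) A σ) =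
      AlgHom.id K _ := by
    refine algHom_eq_of_apply_e fun L => ?_
    obtain ⟨h1, h2⟩ := hσ L L.2
    rw [AlgHom.comp_apply, transfer_e_of_mem h1.1, transfer_e_of_mem (by rw [h2]; exact L.2)]
    simp only [h2]
    rfl
  exact DFunLike.congr_fun this y

/-! ### The exact sequence of deletion and restriction -/

/-- The map of Orlik–Solomon algebras induced by the inclusion of a subarrangement. -/
noncomputable def incl (hBA : B.carrier ⊆ A.carrier) : B.OSAlgebra →ₗ[K] A.OSAlgebra :=
  descend (A.proj.toLinearMap ∘ₗ (transfer B A id).toLinearMap) fun _ hx =>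
    proj_eq_zero_iff.2 (transfer_id_mem_relIdeal hBA hx)

theorem incl_proj (hBA : B.carrier ⊆ A.carrier) (x : B.Ext) :
    incl hBA (B.proj x) = A.proj (transfer B A id x) := descend_proj _ _ x

theorem gen_mul_mem_range_incl (hBA : B.carrier ⊆ A.carrier) {H : A.carrier}
    (hH : (H : Submodule K V) ∈ B.carrier) {w : A.OSAlgebra}
    (hw : w ∈ LinearMap.range (incl hBA)) : A.gen H * w ∈ LinearMap.range (incl hBA) := by
  obtain ⟨w, rfl⟩ := hw
  obtain ⟨y, rfl⟩ := proj_surjective w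
  refine ⟨B.proj (B.e ⟨H, hH⟩ * y), ?_⟩
  rw [incl_proj, incl_proj, map_mul, map_mul, ← proj_e]
  congr 2
  exact transfer_e_of_mem (r := id) (H := ⟨(H : Submodule K V), hH⟩) H.2

theorem proj_transfer_mem_range_incl (hBA : B.carrier ⊆ A.carrier) (x : B.Ext) :
    A.proj (transfer B A id x) ∈ LinearMap.range (incl hBA) := ⟨B.proj x, incl_proj hBA x⟩

theorem proj_monomial_mem_range_incl (hBA : B.carrier ⊆ A.carrier) {p : ℕ}
    {S : Fin p → A.carrier} (hS : ∀ i, (S i : Submodule K V) ∈ B.carrier) :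
    A.proj (A.monomial S) ∈ LinearMap.range (incl hBA) := by
  have h : transfer B A id (B.monomial fun i => ⟨S i, hS i⟩) = A.monomial S :=
    transfer_monomial (r := id) (S := fun i => (⟨S i, hS i⟩ : B.carrier)) fun i => (S i).2
  rw [← h]
  exact proj_transfer_mem_range_incl hBA _

variable [FiniteDimensional K V]

theorem incl_injective (hBA : B.carrier ⊆ A.carrier) : Function.Injective (incl hBA) := by
  rw [injective_iff_map_eq_zero]
  intro w hw
  obtain ⟨x, rfl⟩ := proj_surjective w
  rw [incl_proj, proj_eq_zero_iff] at hw
  exact proj_eq_zero_iff.2 (mem_relIdeal_of_transfer_mem hBA hw)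

/-- The two claims are proved jointly, since contracting e_{H₀} y produces y itself. On generators:
if S avoids H₀, its traces stay dependent and the contraction vanishes; if S = (H₀, T) with T
avoiding H₀, the traces of T are dependent and the two images are e_{T''} and -∂ e_{T''}; if H₀ is
repeated, e_S = 0. -/
theorem transfer_trace_mem_relIdeal (H₀ : A.carrier) {x : A.Ext} (hx : x ∈ A.relIdeal) :
    restrictExt H₀ x ∈ (A.restriction H₀).relIdeal ∧
      restrictExt H₀ (contract H₀ x) ∈ (A.restriction H₀).relIdeal := by
  have hH₀ := A.isCoatom_of_mem H₀ H₀.2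
  have hx' : x ∈ (A.restriction H₀).relSubmodule.comap
        (restrictExt H₀).toLinearMap ⊓
      (A.restriction H₀).relSubmodule.comap
        ((restrictExt H₀).toLinearMap ∘ₗ contract H₀) := by
    refine mem_of_mem_relIdeal _ ?_ ?_ hx
    · intro p S hS
      by_cases h : ∀ i, S i ≠ H₀
      · constructor
        · change restrictExt H₀ _ ∈ (A.restriction H₀).relIdeal
          rw [transfer_boundary_monomial fun i => trace_mem_restriction (h i)]
          refine boundary_monomial_mem_relIdeal (lt_of_le_of_lt ?_ hS)
          rw [iInf_trace]
          exact Submodule.finrank_quotient_comap_subtype_le _ _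
        · change restrictExt H₀ (contract H₀ _) ∈
            (A.restriction H₀).relIdeal
          rw [contract_boundary, contract_monomial h, map_zero, neg_zero, map_zero]
          exact zero_mem _
      · push Not at h
        obtain ⟨k, hk⟩ := h
        obtain ⟨p, rfl⟩ := Nat.exists_eq_succ_of_ne_zero (pos_of_isDependent hS).ne'
        obtain ⟨T, c, h1, h2⟩ := exists_monomial_eq_smul_cons S k
        rw [hk] at h1 h2
        rw [h1, Units.smul_def, map_zsmul]
        refine zsmul_mem ?_ _
        rw [monomial_cons]
        by_cases hT : ∀ i, T i ≠ H₀
        · have hdep : (A.restriction H₀).IsDependent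
              fun i => ⟨trace (H₀ : Submodule K V) (T i), trace_mem_restriction (hT i)⟩ := by
            have h3 := h2 hS
            rw [IsDependent, iInf_cons, Submodule.finrank_quotient_inf_of_isCoatom hH₀] at h3
            rw [IsDependent, iInf_trace]
            exact Nat.lt_of_succ_lt_succ h3
          constructor
          · change restrictExt H₀ _ ∈ (A.restriction H₀).relIdeal
            rw [boundary_e_mul', map_sub, map_mul,
              transfer_e_of_notMem (trace_self_notMem_restriction H₀), zero_mul, sub_zero,
              transfer_monomial fun i => trace_mem_restriction (hT i)]
            exact monomial_mem_relIdeal hdep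
          · change restrictExt H₀ (contract H₀ _) ∈
              (A.restriction H₀).relIdeal
            rw [contract_boundary, contract_e_mul_self, contract_monomial hT, mul_zero, sub_zero,
              map_neg, transfer_boundary_monomial fun i => trace_mem_restriction (hT i)]
            exact neg_mem (boundary_monomial_mem_relIdeal hdep)
        · push Not at hT
          obtain ⟨i, hi⟩ := hT
          rw [← hi, e_mul_monomial_of_mem, map_zero]
          exact zero_mem _
    · rintro H y ⟨hy, hy'⟩
      have h1 : restrictExt H₀ (A.e H * y) ∈
          (A.restriction H₀).relIdeal := by
        rw [map_mul]
        exact Ideal.mul_mem_left _ _ hy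
      refine ⟨h1, ?_⟩
      change restrictExt H₀ (contract H₀ _) ∈
        (A.restriction H₀).relIdeal
      obtain rfl | hne := eq_or_ne H H₀
      · rw [contract_e_mul_self, map_sub, map_mul]
        exact sub_mem hy (Ideal.mul_mem_left _ _ hy')
      · rw [contract_e_mul_of_ne hne, map_neg, map_mul]
        exact neg_mem (Ideal.mul_mem_left _ _ hy')
  exact hx'

/-- The map `A(A) → A(A'')` with `a_{H₀} a_{H₁} ⋯ a_{Hₚ} ↦ a_{H₁''} ⋯ a_{Hₚ''}` that vanishes
on `A(A')`. -/
noncomputable def residue (H₀ : A.carrier) : A.OSAlgebra →ₗ[K] (A.restriction H₀).OSAlgebra :=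
  descend ((A.restriction H₀).proj.toLinearMap ∘ₗ
    (restrictExt H₀).toLinearMap ∘ₗ contract H₀) fun _ hx =>
    proj_eq_zero_iff.2 (transfer_trace_mem_relIdeal H₀ hx).2

theorem residue_proj (H₀ : A.carrier) (x : A.Ext) : residue H₀ (A.proj x) =
    (A.restriction H₀).proj (restrictExt H₀ (contract H₀ x)) :=
  descend_proj _ _ x

theorem residue_proj_e_mul (H₀ : A.carrier) (x : A.Ext) : residue H₀ (A.proj (A.e H₀ * x)) =
    (A.restriction H₀).proj (restrictExt H₀ x) := by
  rw [residue_proj, contract_e_mul_self, map_sub, map_mul,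
    transfer_e_of_notMem (trace_self_notMem_restriction H₀), zero_mul, sub_zero]

theorem residue_incl (H₀ : A.carrier) (w : (A.deletion H₀).OSAlgebra) :
    residue H₀ (incl (deletion_subset A H₀) w) = 0 := by
  obtain ⟨x, rfl⟩ := proj_surjective w
  rw [incl_proj, residue_proj, contract_transfer_deletion, map_zero, map_zero]

/-- Equal traces make H₀ ∩ H ∩ L of codimension at most 2, so (H₀, H, L) is dependent; this is its
relation. -/
theorem gen_mul_sub_gen {H₀ H L : A.carrier}
    (h : trace (H₀ : Submodule K V) H = trace (H₀ : Submodule K V) L) :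
    A.gen H₀ * (A.gen L - A.gen H) = A.gen H * A.gen L := by
  have hdep : A.IsDependent (Fin.cons H₀ (Fin.cons H (Fin.cons L Fin.elim0 :
      Fin 1 → A.carrier) : Fin 2 → A.carrier) : Fin 3 → A.carrier) := by
    rw [IsDependent, iInf_cons, iInf_cons, iInf_cons, iInf_of_empty, inf_top_eq,
      Submodule.finrank_quotient_inf_of_isCoatom (A.isCoatom_of_mem H₀ H₀.2), Submodule.comap_inf]
    have h' : Submodule.comap (H₀ : Submodule K V).subtype H =
        Submodule.comap (H₀ : Submodule K V).subtype L := h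
    rw [h', inf_idem]
    have h1 := Submodule.finrank_quotient_comap_subtype_le (H₀ : Submodule K V) L
    have h2 : Module.finrank K (V ⧸ (L : Submodule K V)) = 1 :=
      isSimpleModule_iff_finrank_eq_one.1 (isSimpleModule_iff_isCoatom.2 (A.isCoatom_of_mem L L.2))
    omega
  have hrel := proj_eq_zero_iff.2 (boundary_monomial_mem_relIdeal hdep)
  rw [monomial_cons, monomial_cons, monomial_cons, monomial_zero, boundary_e_mul',
    boundary_e_mul', boundary_e_mul', boundary_one, mul_zero, sub_zero, mul_one, mul_one] at hrel
  simp only [map_sub, map_mul, proj_e] at hrel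
  exact (sub_eq_zero.1 hrel).symm

section Section

variable {H₀ : A.carrier} {σ : Submodule K (H₀ : Submodule K V) → Submodule K V}
  (hσ : ∀ L ∈ (A.restriction H₀).carrier,
    σ L ∈ (A.deletion H₀).carrier ∧ trace (H₀ : Submodule K V) (σ L) = L)

include hσ

/-- If S is dependent in H₀, then (H₀, σS) is dependent in V, and its relation reads a_{H₀} ∂ a_{σS}
= a_{σS}, which avoids H₀. -/
theorem gen_mul_proj_transfer_section_mem {y : (A.restriction H₀).Ext}
    (hy : y ∈ (A.restriction H₀).relIdeal) :
    A.gen H₀ * A.proj (transfer (A.restriction H₀) A σ y) ∈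
      LinearMap.range (incl (deletion_subset A H₀)) := by
  refine mem_of_mem_relIdeal ((LinearMap.range (incl (deletion_subset A H₀))).comap
    (LinearMap.mulLeft K (A.gen H₀) ∘ₗ A.proj.toLinearMap ∘ₗ
      (transfer (A.restriction H₀) A σ).toLinearMap)) ?_ ?_ hy
  · intro p S hS
    change A.gen H₀ * A.proj (transfer (A.restriction H₀) A σ _) ∈
      LinearMap.range (incl (deletion_subset A H₀))
    have hmem (i) : σ (S i) ∈ A.carrier := (hσ _ (S i).2).1.1
    rw [transfer_boundary_monomial hmem]
    have hdep : A.IsDependent (Fin.cons H₀ fun i => ⟨σ (S i), hmem i⟩ :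
        Fin (p + 1) → A.carrier) := by
      rw [IsDependent, iInf_cons,
        Submodule.finrank_quotient_inf_of_isCoatom (A.isCoatom_of_mem H₀ H₀.2), ← iInf_trace]
      have h : ⨅ i, trace (H₀ : Submodule K V) (σ (S i)) = ⨅ i, (S i : Submodule K _) :=
        iInf_congr fun i => (hσ _ (S i).2).2
      rw [h]
      exact Nat.succ_lt_succ hS
    have hrel := proj_eq_zero_iff.2 (boundary_monomial_mem_relIdeal hdep)
    rw [monomial_cons, boundary_e_mul', map_sub, sub_eq_zero, map_mul, proj_e] at hrel
    rw [← hrel]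
    exact proj_monomial_mem_range_incl _ fun i => (hσ _ (S i).2).1
  · intro L y hy
    change A.gen H₀ * A.proj (transfer (A.restriction H₀) A σ _) ∈
      LinearMap.range (incl (deletion_subset A H₀))
    obtain ⟨h1, -⟩ := hσ L L.2
    rw [map_mul, transfer_e_of_mem h1.1, ← proj_e, ← map_mul, e_mul_e_mul_comm, map_neg, map_mul,
      map_mul, proj_e]
    exact neg_mem (gen_mul_mem_range_incl _ h1 hy)

/-- Replacing each hyperplane by the chosen one with the same trace changes a_{H₀} z only by an
element of A(𝒜'). One factor is exchanged at a time with `gen_mul_sub_gen`. -/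
theorem gen_mul_proj_sub_mem (z : (A.deletion H₀).Ext) :
    A.gen H₀ * A.proj (transfer (A.restriction H₀) A σ (restrictExt H₀
      (transfer (A.deletion H₀) A id z)) - transfer (A.deletion H₀) A id z) ∈
      LinearMap.range (incl (deletion_subset A H₀)) := by
  refine mem_of_e_mul_mem ((LinearMap.range (incl (deletion_subset A H₀))).comap
    (LinearMap.mulLeft K (A.gen H₀) ∘ₗ A.proj.toLinearMap ∘ₗ
      ((transfer (A.restriction H₀) A σ).toLinearMap ∘ₗ
        (restrictExt H₀).toLinearMap ∘ₗ
        (transfer (A.deletion H₀) A id).toLinearMap -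
        (transfer (A.deletion H₀) A id).toLinearMap))) ?_ ?_ z
  · change A.gen H₀ * A.proj (transfer (A.restriction H₀) A σ (restrictExt H₀
      (transfer (A.deletion H₀) A id 1)) - transfer (A.deletion H₀) A id 1) ∈
      LinearMap.range (incl (deletion_subset A H₀))
    simp
  · intro H z hz
    change A.gen H₀ * A.proj (transfer (A.restriction H₀) A σ (restrictExt H₀
      (transfer (A.deletion H₀) A id _)) - transfer (A.deletion H₀) A id _) ∈
      LinearMap.range (incl (deletion_subset A H₀))
    have hz' : A.gen H₀ * A.proj (transfer (A.restriction H₀) A σ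
      (restrictExt H₀ (transfer (A.deletion H₀) A id z)) - transfer (A.deletion H₀) A id z) ∈
      LinearMap.range (incl (deletion_subset A H₀)) := hz
    have hH : (⟨H, H.2.1⟩ : A.carrier) ≠ H₀ := fun h => H.2.2 (congrArg Subtype.val h)
    obtain ⟨h1, h2⟩ := hσ _ (trace_mem_restriction hH)
    have he : transfer (A.deletion H₀) A id ((A.deletion H₀).e H) = A.e ⟨H, H.2.1⟩ :=
      transfer_e_of_mem (r := id) H.2.1
    rw [map_mul, he, map_mul, transfer_e_of_mem (trace_mem_restriction hH), map_mul,
      transfer_e_of_mem h1.1]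
    set L : A.carrier := ⟨σ (trace (H₀ : Submodule K V) H), h1.1⟩ with hL
    set a := transfer (A.deletion H₀) A id z
    set b := transfer (A.restriction H₀) A σ (restrictExt H₀ a)
    have hsplit : A.gen H₀ * A.proj (A.e L * b - A.e ⟨H, H.2.1⟩ * a) =
        -(A.gen L * (A.gen H₀ * A.proj (b - a))) +
          A.gen H₀ * (A.gen L - A.gen ⟨H, H.2.1⟩) * A.proj a := by
      have hcomm : A.gen H₀ * A.gen L = -(A.gen L * A.gen H₀) := by
        rw [← proj_e, ← proj_e, ← map_mul, e_mul_e_comm, map_neg, map_mul]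
      simp only [map_sub, map_mul, proj_e]
      rw [← mul_assoc (A.gen L), ← neg_mul, ← hcomm]
      noncomm_ring
    rw [hsplit, gen_mul_sub_gen h2.symm, mul_assoc]
    refine add_mem (neg_mem (gen_mul_mem_range_incl _ h1 hz')) ?_
    exact gen_mul_mem_range_incl (H := ⟨H, H.2.1⟩) _ H.2 (gen_mul_mem_range_incl (H := L) _ h1
      (proj_transfer_mem_range_incl _ z))

end Section

theorem exact_incl_residue (H₀ : A.carrier) :
    Function.Exact (incl (deletion_subset A H₀)) (residue H₀) := by
  intro w
  constructor
  · intro hw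
    obtain ⟨σ, hσ⟩ := exists_section_trace H₀
    obtain ⟨x, rfl⟩ := proj_surjective w
    -- For x = y + e_{H₀} z the residue is z''. If it vanishes, a_{H₀} σ(z'') and a_{H₀} (σ(z'') -
    -- z) lie in A(𝒜'), hence so does a_{H₀} z.
    obtain ⟨y, z, rfl⟩ := exists_eq_transfer_deletion_add H₀ x
    rw [map_add, map_add, residue_proj, contract_transfer_deletion, map_zero, map_zero, zero_add,
      residue_proj_e_mul, proj_eq_zero_iff] at hw
    have h1 := gen_mul_proj_transfer_section_mem hσ hw
    have h2 := gen_mul_proj_sub_mem hσ z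
    have h3 := sub_mem h1 h2
    rw [← mul_sub, ← map_sub, sub_sub_cancel] at h3
    have h4 := add_mem (proj_transfer_mem_range_incl (deletion_subset A H₀) y) h3
    rw [← proj_e, ← map_mul, ← map_add] at h4
    exact h4
  · rintro ⟨w, rfl⟩
    exact residue_incl H₀ w

theorem residue_surjective (H₀ : A.carrier) : Function.Surjective (residue H₀) := by
  intro w
  obtain ⟨σ, hσ⟩ := exists_section_trace H₀
  obtain ⟨y, rfl⟩ := proj_surjective w
  refine ⟨A.proj (A.e H₀ * transfer (A.restriction H₀) A σ y), ?_⟩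
  rw [residue_proj_e_mul, transfer_trace_transfer_section hσ]

end CentralArrangement

namespace CentralArrangement

variable {K : Type u} {V : Type v} [Field K] [AddCommGroup V] [Module K V]
variable {A : CentralArrangement K V}

/-! ### Tensor factorizations in terms of bases -/

/-- For a block labelled by `l`, the family consisting of `1` and of the `e_H`, for `H` in the
block. -/
noncomputable def blockVec {T : Type*} (l : T → A.carrier) (o : Option T) : A.Ext :=
  o.elim 1 fun t => A.e (l t)

/-- The product of a choice of one element of the family `1, e_H` for each block. -/
noncomputable def factorMonomial {s : ℕ} {T : Fin s → Type*} (l : ∀ i, T i → A.carrier)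
    (c : ∀ i, Option (T i)) : A.Ext :=
  (List.ofFn fun i => blockVec (l i) (c i)).prod

/-- The degree of an element of the family `1, e_H`. -/
def blockDegree {T : Type*} (o : Option T) : ℕ := o.elim 0 fun _ => 1

theorem blockVec_mem {T : Type*} (l : T → A.carrier) (o : Option T) :
    blockVec l o ∈ ⋀[K]^(blockDegree o) (A.carrier →₀ K) :=
  match o with
  | none => SetLike.GradedOne.one_mem (A := fun i : ℕ => ⋀[K]^i (A.carrier →₀ K))
  | some t => e_mem (l t)

theorem prod_mem_exteriorPower {s : ℕ} {d : Fin s → ℕ} {y : Fin s → A.Ext}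
    (hy : ∀ i, y i ∈ ⋀[K]^(d i) (A.carrier →₀ K)) :
    (List.ofFn y).prod ∈ ⋀[K]^(∑ i, d i) (A.carrier →₀ K) := by
  have h := SetLike.list_prod_ofFn_mem_graded (A := fun i : ℕ => ⋀[K]^i (A.carrier →₀ K)) d y hy
  rwa [List.sum_ofFn] at h

theorem proj_list_prod {s : ℕ} (y : Fin s → A.Ext) :
    A.proj (List.ofFn y).prod = (List.ofFn fun i => A.proj (y i)).prod := by
  rw [map_list_prod, List.map_ofFn]
  rfl

theorem proj_mem_component {n : ℕ} {x : A.Ext} (hx : x ∈ ⋀[K]^n (A.carrier →₀ K)) :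
    A.proj x ∈ A.component n := ⟨x, hx, rfl⟩

theorem kappa_tprod {s : ℕ} (P : Fin s → Set (Submodule K V)) (x : ∀ i, A.blockSpace (P i)) :
    A.kappa P (PiTensorProduct.tprod K x) = (List.ofFn fun i => (x i : A.OSAlgebra)).prod := by
  rw [kappa, PiTensorProduct.lift.tprod, MultilinearMap.compLinearMap_apply,
    MultilinearMap.mkPiAlgebraFin_apply]
  rfl

variable (A) in
/-- The projection of the Orlik–Solomon algebra onto its component of degree `n`. -/
noncomputable def componentProj (n : ℕ) : A.OSAlgebra →ₗ[K] A.OSAlgebra :=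
  descend (A.proj.toLinearMap ∘ₗ GradedAlgebra.proj (fun i : ℕ => ⋀[K]^i (A.carrier →₀ K)) n)
    fun _ hx => proj_eq_zero_iff.2 (isHomogeneous_relIdeal n hx)

theorem componentProj_proj (n : ℕ) (x : A.Ext) : A.componentProj n (A.proj x) =
    A.proj (DirectSum.decompose (fun i : ℕ => ⋀[K]^i (A.carrier →₀ K)) x n : A.Ext) :=
  descend_proj _ _ x

theorem componentProj_of_mem {n : ℕ} {w : A.OSAlgebra} (hw : w ∈ A.component n) :
    A.componentProj n w = w := by
  obtain ⟨x, hx, rfl⟩ := hw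
  change A.componentProj n (A.proj x) = A.proj x
  rw [componentProj_proj,
    DirectSum.decompose_of_mem_same (fun i : ℕ => ⋀[K]^i (A.carrier →₀ K)) hx]

theorem componentProj_of_mem_ne {m n : ℕ} {w : A.OSAlgebra} (hw : w ∈ A.component m)
    (hmn : m ≠ n) : A.componentProj n w = 0 := by
  obtain ⟨x, hx, rfl⟩ := hw
  change A.componentProj n (A.proj x) = 0
  rw [componentProj_proj,
    DirectSum.decompose_of_mem_ne (fun i : ℕ => ⋀[K]^i (A.carrier →₀ K)) hx hmn, map_zero]

theorem span_proj_blockVec {T : Type*} {l : T → A.carrier} {B : Set (Submodule K V)}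
    (hl : ∀ H : A.carrier, (H : Submodule K V) ∈ B ↔ H ∈ Set.range l) :
    Submodule.span K (Set.range fun o => A.proj (blockVec l o)) = A.blockSpace B := by
  have h : {H : A.carrier | (H : Submodule K V) ∈ B} = Set.range l := Set.ext hl
  rw [Option.range_eq, Submodule.span_insert, blockSpace, h, ← Set.range_comp]
  change Submodule.span K {A.proj 1} ⊔ _ = _
  rw [map_one]
  rfl

variable [FiniteDimensional K V]

/-- The truncation to degrees 0 and 1 descends to the Orlik–Solomon algebra and separates 1 from the
a_H and the a_H from each other. -/
theorem linearIndependent_proj_blockVec {T : Type*} {l : T → A.carrier}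
    (hl : Function.Injective l) : LinearIndependent K fun o => A.proj (blockVec l o) := by
  let f : A.OSAlgebra →ₗ[K] TrivSqZeroExt K (A.carrier →₀ K) :=
    descend ExteriorAlgebra.toTrivSqZeroExt.toLinearMap fun _ hx => toTrivSqZeroExt_eq_zero hx
  have hf (x : A.Ext) : f (A.proj x) = ExteriorAlgebra.toTrivSqZeroExt x := descend_proj _ _ x
  have hsome (t : T) : f (A.proj (blockVec l (some t))) =
      TrivSqZeroExt.inr (Finsupp.single (l t) 1) :=
    (hf _).trans (ExteriorAlgebra.toTrivSqZeroExt_ι _)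
  have hnone : f (A.proj (blockVec l none)) = 1 :=
    (hf _).trans (map_one (ExteriorAlgebra.toTrivSqZeroExt (R := K) (M := A.carrier →₀ K)))
  rw [linearIndependent_option]
  constructor
  · refine LinearIndependent.of_comp (TrivSqZeroExt.sndHom K _ ∘ₗ f) ?_
    have h := (Finsupp.linearIndependent_single_one K A.carrier).comp l hl
    convert h using 1
    funext t
    change TrivSqZeroExt.snd (f (A.proj (blockVec l (some t)))) = _
    rw [hsome, TrivSqZeroExt.snd_inr]
    rfl
  · intro hmem
    have hle : Submodule.span K (Set.range ((fun o => A.proj (blockVec l o)) ∘ some)) ≤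
        LinearMap.ker ((TrivSqZeroExt.fstHom K K (A.carrier →₀ K)).toLinearMap ∘ₗ f) := by
      rw [Submodule.span_le]
      rintro _ ⟨t, rfl⟩
      change TrivSqZeroExt.fst (f (A.proj (blockVec l (some t)))) = 0
      rw [hsome, TrivSqZeroExt.fst_inr]
    have h : TrivSqZeroExt.fst (f (A.proj (blockVec l none))) = 0 := hle hmem
    rw [hnone, TrivSqZeroExt.fst_one] at h
    exact one_ne_zero h

/-- A basis of `[B]`, consisting of `1` and of the `a_H`, for `H ∈ B`. -/
theorem exists_basis_blockSpace {T : Type*} {l : T → A.carrier} {B : Set (Submodule K V)}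
    (hl : Function.Injective l)
    (hB : ∀ H : A.carrier, (H : Submodule K V) ∈ B ↔ H ∈ Set.range l) :
    ∃ b : Module.Basis (Option T) K (A.blockSpace B),
      ∀ o, (b o : A.OSAlgebra) = A.proj (blockVec l o) := by
  refine ⟨(Module.Basis.span (linearIndependent_proj_blockVec hl)).map
    (LinearEquiv.ofEq _ _ (span_proj_blockVec hB)), fun o => ?_⟩
  rw [Module.Basis.map_apply, LinearEquiv.coe_ofEq_apply, Module.Basis.span_apply]

/-- The multiplication map is an isomorphism of graded spaces if and only if the products of
choices of one element of the family `1, a_H` for each block form a basis. -/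
theorem isTensorFactorization_iff {s : ℕ} {P : Fin s → Set (Submodule K V)}
    {T : Fin s → Type*} {l : ∀ i, T i → A.carrier} (hl : ∀ i, Function.Injective (l i))
    (hP : ∀ i, ∀ H : A.carrier, (H : Submodule K V) ∈ P i ↔ H ∈ Set.range (l i)) :
    A.IsTensorFactorization P ↔ Function.Bijective
      (Finsupp.linearCombination K fun c : ∀ i, Option (T i) => A.proj (factorMonomial l c)) := by
  choose b hb using fun i => exists_basis_blockSpace (hl i) (hP i)
  have hκ (c : ∀ i, Option (T i)) :
      A.kappa P (Basis.piTensorProduct b c) = A.proj (factorMonomial l c) := by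
    rw [Basis.piTensorProduct_apply, kappa_tprod, factorMonomial, proj_list_prod]
    simp only [hb]
  have hbij : Function.Bijective (A.kappa P) ↔ Function.Bijective
      (Finsupp.linearCombination K fun c : ∀ i, Option (T i) => A.proj (factorMonomial l c)) := by
    have h : Finsupp.linearCombination K
        (fun c : ∀ i, Option (T i) => A.proj (factorMonomial l c)) =
          A.kappa P ∘ₗ (Basis.piTensorProduct b).repr.symm.toLinearMap := by
      refine Finsupp.lhom_ext' fun c => LinearMap.ext_ring ?_
      simpa using (hκ c).symm
    rw [h, LinearMap.coe_comp]
    exact (EquivLike.bijective_comp (Basis.piTensorProduct b).repr.symm (A.kappa P)).symm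
  refine ⟨fun h => hbij.1 h.1, fun h => ⟨hbij.2 h, fun n => le_antisymm ?_ ?_⟩⟩
  · rw [Submodule.map_le_iff_le_comap, tensorComponent, Submodule.span_le]
    rintro _ ⟨d, x, rfl, hx, rfl⟩
    choose y hy hyx using hx
    change A.kappa P _ ∈ A.component _
    have hyx' : ∀ i, (x i : A.OSAlgebra) = A.proj (y i) := fun i => (hyx i).symm
    rw [kappa_tprod]
    simp only [hyx']
    rw [← proj_list_prod]
    exact proj_mem_component (prod_mem_exteriorPower hy)
  · intro w hw
    obtain ⟨t, rfl⟩ := (hbij.2 h).2 w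
    -- Expand t in the tensor basis. Each basis tensor has a homogeneous image, which the projection
    -- to degree n either fixes or kills.
    rw [← componentProj_of_mem hw]
    have ht : t ∈ Submodule.span K (Set.range (Basis.piTensorProduct b)) := by
      rw [Module.Basis.span_eq]
      trivial
    suffices Submodule.span K (Set.range (Basis.piTensorProduct b)) ≤
        ((A.tensorComponent P n).map (A.kappa P)).comap (A.componentProj n ∘ₗ A.kappa P) from
      this ht
    rw [Submodule.span_le]
    rintro _ ⟨c, rfl⟩
    have hc : A.proj (factorMonomial l c) ∈ A.component (∑ i, blockDegree (c i)) :=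
      proj_mem_component (prod_mem_exteriorPower fun i => blockVec_mem (l i) (c i))
    change A.componentProj n (A.kappa P (Basis.piTensorProduct b c)) ∈
      (A.tensorComponent P n).map (A.kappa P)
    by_cases hn : ∑ i, blockDegree (c i) = n
    · rw [hn] at hc
      rw [hκ, componentProj_of_mem hc, ← hκ]
      refine Submodule.mem_map_of_mem (Submodule.subset_span ?_)
      refine ⟨fun i => blockDegree (c i), fun i => b i (c i), hn, fun i => ?_,
        Basis.piTensorProduct_apply b c⟩
      rw [hb]
      exact proj_mem_component (blockVec_mem (l i) (c i))
    · rw [hκ, componentProj_of_mem_ne hc hn]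
      exact zero_mem _

end CentralArrangement

namespace CentralArrangement

/-! ### The short five lemma -/

section ExactSequence

variable {R X Z U W Q : Type*} [Ring R] [AddCommGroup X] [AddCommGroup Z] [AddCommGroup U]
  [AddCommGroup W] [AddCommGroup Q] [Module R X] [Module R Z] [Module R U] [Module R W]
  [Module R Q] {i : U →ₗ[R] W} {j : W →ₗ[R] Q} {α : X →ₗ[R] U} {β : X × Z →ₗ[R] W}
  {γ : Z →ₗ[R] Q}

/-- For a map from a split short exact sequence to a short exact sequence, two of the three
components being bijective implies the third. -/
theorem bijective_two_of_three (hi : Function.Injective i) (hij : Function.Exact i j)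
    (hj : Function.Surjective j) (hα : ∀ x, β (x, 0) = i (α x)) (hγ : ∀ x z, j (β (x, z)) = γ z) :
    (Function.Bijective β ∧ Function.Bijective α → Function.Bijective γ) ∧
    (Function.Bijective β ∧ Function.Bijective γ → Function.Bijective α) ∧
    (Function.Bijective α ∧ Function.Bijective γ → Function.Bijective β) := by
  refine ⟨fun ⟨hβ, hα'⟩ => ⟨?_, ?_⟩, fun ⟨hβ, hγ'⟩ => ⟨?_, ?_⟩, fun ⟨hα', hγ'⟩ => ⟨?_, ?_⟩⟩
  · rw [injective_iff_map_eq_zero]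
    intro z hz
    obtain ⟨u, hu⟩ := (hij _).1 ((hγ 0 z).trans hz)
    obtain ⟨x, rfl⟩ := hα'.2 u
    exact (congrArg Prod.snd (hβ.1 ((hα x).trans hu))).symm
  · intro q
    obtain ⟨w, rfl⟩ := hj q
    obtain ⟨⟨x, z⟩, rfl⟩ := hβ.2 w
    exact ⟨z, (hγ x z).symm⟩
  · rw [injective_iff_map_eq_zero]
    intro x hx
    have h := hα x
    rw [hx, map_zero, ← map_zero β] at h
    exact congrArg Prod.fst (hβ.1 h)
  · intro u
    obtain ⟨⟨x, z⟩, hxz⟩ := hβ.2 (i u)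
    have hz : γ z = γ 0 := by rw [← hγ x z, hxz, hij.apply_apply_eq_zero, map_zero]
    obtain rfl := hγ'.1 hz
    exact ⟨x, hi ((hα x).symm.trans hxz)⟩
  · rw [injective_iff_map_eq_zero]
    rintro ⟨x, z⟩ hxz
    have hz : γ z = γ 0 := by rw [← hγ x z, hxz, map_zero, map_zero]
    obtain rfl := hγ'.1 hz
    have hx : α x = α 0 := hi (by rw [← hα, hxz, map_zero, map_zero])
    rw [hα'.1 hx]
    rfl
  · intro w
    obtain ⟨z, hz⟩ := hγ'.2 (j w)
    obtain ⟨u, hu⟩ := (hij (w - β (0, z))).1 (by rw [map_sub, hγ, hz, sub_self])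
    obtain ⟨x, rfl⟩ := hα'.2 u
    refine ⟨(x, z), ?_⟩
    have h : ((x, z) : X × Z) = (x, 0) + (0, z) := by simp
    rw [h, map_add, hα, hu, sub_add_cancel]

end ExactSequence

/-! ### Splitting the choices according to H₀ -/

theorem bijective_linearCombination_iff {R M C C' C'' : Type*} [Ring R] [AddCommGroup M]
    [Module R M] (φ : C → M) {f : C' → C} {g : C'' → C} (h : Function.Bijective (Sum.elim f g)) :
    Function.Bijective (Finsupp.linearCombination R φ) ↔ Function.Bijective
      ((Finsupp.linearCombination R (φ ∘ f)).coprod (Finsupp.linearCombination R (φ ∘ g))) := by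
  let ε : ((C' →₀ R) × (C'' →₀ R)) ≃ₗ[R] (C →₀ R) :=
    (Finsupp.sumFinsuppLEquivProdFinsupp R).symm ≪≫ₗ
      Finsupp.domLCongr (Equiv.ofBijective _ h)
  have h : (Finsupp.linearCombination R (φ ∘ f)).coprod (Finsupp.linearCombination R (φ ∘ g)) =
      Finsupp.linearCombination R φ ∘ₗ ε.toLinearMap := by
    refine LinearMap.prod_ext ?_ ?_ <;>
    · refine Finsupp.lhom_ext' fun c => LinearMap.ext_ring ?_
      simp [ε]
  rw [h, LinearMap.coe_comp]
  exact (EquivLike.bijective_comp ε (Finsupp.linearCombination R φ)).symm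

/-- A choice of at most one element of each block either selects `t₀` in the first block, or it
never selects `t₀`. -/
theorem bijective_sumElim_map_val_cons {s : ℕ} {T : Fin (s + 1) → Type*} (t₀ : T 0)
    (q : ∀ i, T i → Prop) (h0 : ∀ t, q 0 t ↔ t ≠ t₀) (hsucc : ∀ (i : Fin s) (t : T i.succ),
      q i.succ t) :
    Function.Bijective (Sum.elim
      (fun (c : ∀ i, Option {t // q i t}) i => (c i).map Subtype.val)
      (fun c : ∀ i : Fin s, Option (T i.succ) =>
        Fin.cons (α := fun i => Option (T i)) (some t₀) c)) := by
  constructor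
  · refine Function.Injective.sumElim ?_ ?_ ?_
    · intro c d h
      exact funext fun i => Option.map_injective Subtype.val_injective (congrFun h i)
    · exact fun c d h => (Fin.cons_right_injective (α := fun i => Option (T i)) _) h
    · intro c d h
      have hc : (c 0).map Subtype.val = some t₀ := congrFun h 0
      obtain ⟨t, -, ht⟩ := Option.map_eq_some_iff.1 hc
      exact (h0 _).1 t.2 ht
  · intro c
    by_cases hc0 : c 0 = some t₀
    · refine ⟨Sum.inr fun i => c i.succ, funext fun i => Fin.cases ?_ (fun i => ?_) i⟩
      · exact hc0.symm
      · rfl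
    · have hex (i) : ∃ o : Option {t // q i t}, o.map Subtype.val = c i := by
        cases hc : c i with
        | none => exact ⟨none, rfl⟩
        | some t =>
          refine ⟨some ⟨t, ?_⟩, rfl⟩
          obtain rfl | ⟨i, rfl⟩ := Fin.eq_zero_or_eq_succ i
          · exact (h0 t).2 fun ht => hc0 (hc.trans (congrArg some ht))
          · exact hsucc i t
      choose d hd using hex
      exact ⟨Sum.inl d, funext hd⟩

variable {K : Type u} {V W : Type v} [Field K] [AddCommGroup V] [Module K V]
  [AddCommGroup W] [Module K W]

theorem transfer_factorMonomial {A : CentralArrangement K V} {B : CentralArrangement K W}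
    {r : Submodule K V → Submodule K W} {s : ℕ} {T T' : Fin s → Type*}
    {l : ∀ i, T i → A.carrier} {l' : ∀ i, T' i → B.carrier} (f : ∀ i, T i → T' i)
    (h : ∀ i t, r (l i t) = l' i (f i t)) (c : ∀ i, Option (T i)) :
    transfer A B r (factorMonomial l c) = factorMonomial l' fun i => (c i).map (f i) := by
  rw [factorMonomial, factorMonomial, map_list_prod, List.map_ofFn]
  congr 2
  funext i
  change transfer A B r (blockVec (l i) (c i)) = _
  cases c i with
  | none => exact map_one _
  | some t =>
    change transfer A B r (A.e (l i t)) = B.e (l' i (f i t))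
    rw [transfer_e_of_mem (by rw [h]; exact (l' i (f i t)).2)]
    simp only [h]

/-- The first block stands leftmost, so e_{H₀} can be stripped off by the residue without a sign. -/
theorem factorMonomial_cons_some {A : CentralArrangement K V} {s : ℕ} {T : Fin (s + 1) → Type*}
    (l : ∀ i, T i → A.carrier) (t : T 0) (c : ∀ i : Fin s, Option (T i.succ)) :
    factorMonomial l (Fin.cons (α := fun i => Option (T i)) (some t) c) =
      A.e (l 0 t) * factorMonomial (fun i => l i.succ) c := by
  rw [factorMonomial, List.ofFn_succ, List.prod_cons]
  rfl

end CentralArrangement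

/-! ### Comparison with the deletion–restriction sequence -/

open CentralArrangement in
theorem theorem1p1 {K : Type u} {V : Type v} [Field K] [AddCommGroup V] [Module K V]
    [FiniteDimensional K V] (A : CentralArrangement K V) {s : ℕ}
    (P : Fin (s + 1) → Set (Submodule K V)) (hP : A.IsPartition P)
    (H₀ : Submodule K V) (hH₀ : H₀ ∈ P 0)
    (hR : Set.BijOn (CentralArrangement.trace H₀) (A.carrier \ P 0) (A.restriction H₀).carrier) :
    (A.IsTensorFactorization P ∧
        (A.deletion H₀).IsTensorFactorization (A.deletionBlocks H₀ P) →
      (A.restriction H₀).IsTensorFactorization (CentralArrangement.restrictionBlocks H₀ P)) ∧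
    (A.IsTensorFactorization P ∧
        (A.restriction H₀).IsTensorFactorization (CentralArrangement.restrictionBlocks H₀ P) →
      (A.deletion H₀).IsTensorFactorization (A.deletionBlocks H₀ P)) ∧
    ((A.deletion H₀).IsTensorFactorization (A.deletionBlocks H₀ P) ∧
        (A.restriction H₀).IsTensorFactorization (CentralArrangement.restrictionBlocks H₀ P) →
      A.IsTensorFactorization P) := by
  have hPA (i) : P i ⊆ A.carrier := hP.iUnion_eq ▸ Set.subset_iUnion P i
  have hsucc (i : Fin s) : P i.succ ⊆ A.carrier \ P 0 := fun H hH =>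
    ⟨hPA _ hH, fun h => Set.disjoint_left.1 (hP.disjoint (Fin.succ_ne_zero i)) hH h⟩
  have hne {i : Fin s} {H : Submodule K V} (hH : H ∈ P i.succ) : H ≠ H₀ := fun h =>
    (hsucc i hH).2 (h ▸ hH₀)
  let h₀ : A.carrier := ⟨H₀, hPA 0 hH₀⟩
  let T' : Fin (s + 1) → Type v := fun i => {H : P i // (H : Submodule K V) ≠ H₀}
  let l : ∀ i, P i → A.carrier := fun i H => ⟨H, hPA i H.2⟩
  let l' : ∀ i, T' i → (A.deletion H₀).carrier := fun i H => ⟨H.1, hPA i H.1.2, H.2⟩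
  let l'' : ∀ i : Fin s, P i.succ → (A.restriction H₀).carrier := fun i H =>
    ⟨trace H₀ H, hR.mapsTo (hsucc i H.2)⟩
  have hA := isTensorFactorization_iff (A := A) (P := P) (l := l)
    (fun i H L h => Subtype.ext (congrArg (fun x : A.carrier => (x : Submodule K V)) h))
    (fun i H => ⟨fun h => ⟨⟨H, h⟩, rfl⟩, by rintro ⟨L, rfl⟩; exact L.2⟩)
  have hA' := isTensorFactorization_iff (A := A.deletion H₀) (P := A.deletionBlocks H₀ P) (l := l')
    (fun i H L h => Subtype.ext (Subtype.ext
      (congrArg (fun x : (A.deletion H₀).carrier => (x : Submodule K V)) h)))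
    (fun i H => ⟨fun h => ⟨⟨⟨H, h.1⟩, h.2.2⟩, rfl⟩, by rintro ⟨L, rfl⟩; exact ⟨L.1.2, (l' i L).2⟩⟩)
  have hA'' := isTensorFactorization_iff (A := A.restriction H₀) (P := restrictionBlocks H₀ P)
    (l := l'')
    -- Injectivity of R keeps the labels in each restricted block distinct.
    (fun i H L h => Subtype.ext (hR.injOn (hsucc i H.2) (hsucc i L.2)
      (congrArg (fun x : (A.restriction H₀).carrier => (x : Submodule K H₀)) h)))
    (fun i H => ⟨fun ⟨L, hL, hLH⟩ => ⟨⟨L, hL⟩, Subtype.ext hLH⟩, by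
      rintro ⟨L, rfl⟩; exact ⟨L, L.2, rfl⟩⟩)
  rw [hA, hA', hA'']
  let inc' : (∀ i, Option (T' i)) → ∀ i, Option (P i) := fun c i => (c i).map Subtype.val
  let inc'' : (∀ i : Fin s, Option (P i.succ)) → ∀ i, Option (P i) := fun c =>
    Fin.cons (α := fun i => Option (P i)) (some ⟨H₀, hH₀⟩) c
  have hinc : Function.Bijective (Sum.elim inc' inc'') :=
    bijective_sumElim_map_val_cons (T := fun i => P i) ⟨H₀, hH₀⟩
      (fun i (H : P i) => (H : Submodule K V) ≠ H₀)
      (fun H => ⟨fun h h' => h (congrArg Subtype.val h'), fun h h' => h (Subtype.ext h')⟩)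
      fun i H => hne H.2
  let φ := fun c : ∀ i, Option (P i) => A.proj (factorMonomial l c)
  have hβ := bijective_linearCombination_iff (R := K) φ hinc
  rw [hβ]
  have hα (x) : Finsupp.linearCombination K (φ ∘ inc') x = incl (deletion_subset A H₀)
      (Finsupp.linearCombination K (fun c => (A.deletion H₀).proj (factorMonomial l' c)) x) := by
    rw [← LinearMap.comp_apply (incl _)]
    refine LinearMap.congr_fun (Finsupp.lhom_ext' fun c => LinearMap.ext_ring ?_) x
    simp only [LinearMap.comp_apply, Finsupp.lsingle_apply, Finsupp.linearCombination_single,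
      one_smul, incl_proj]
    rw [transfer_factorMonomial (l' := l) (fun i => Subtype.val) fun i t => rfl]
    rfl
  refine bijective_two_of_three (incl_injective (deletion_subset A H₀))
    (exact_incl_residue h₀) (residue_surjective h₀) (fun x => ?_) (fun x z => ?_)
  · rw [LinearMap.coprod_apply, map_zero, add_zero, hα]
  -- The part from 𝒜' has residue zero; on the rest it suffices to compare e_{H₀} times a product
  -- with the product of the traces.
  · rw [LinearMap.coprod_apply, map_add, hα]
    refine (congrArg (· + _) (residue_incl h₀ _)).trans ?_
    rw [zero_add, ← LinearMap.comp_apply (residue h₀)]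
    refine LinearMap.congr_fun (Finsupp.lhom_ext' fun c => LinearMap.ext_ring ?_) z
    simp only [LinearMap.comp_apply, Finsupp.lsingle_apply, Finsupp.linearCombination_single,
      one_smul, φ, inc'', Function.comp_apply, factorMonomial_cons_some]
    refine (residue_proj_e_mul h₀ _).trans ?_
    rw [restrictExt, transfer_factorMonomial (l' := l'') (fun i => id) fun i t => rfl]
    simp only [Option.map_id, id]
    rfl
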